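/- For $n\ge 1$ and $f:\{0,1\}^n\to\{0,1\}$ let $|f\rangle=2^{-n/2}\sum_{x\in\{0,1\}^n}|x,f(x)\rangle$ be the function state and $g=(-1)^f$. Call $f$ monotone if $f(x)\le f(y)$ whenever $x_i\le y_i$ for all $i$, and $\varepsilon$-far from monotone if $\Pr_{x}[f(x)\ne h(x)]\ge\varepsilon$ for every monotone $h:\{0,1\}^n\to\{0,1\}$ ($x$ uniform). Write $\hat g(S)=\mathbb E_x\big[g(x)\prod_{i\in S}(-1)^{x_i}\big]$ for the Fourier coefficients, $D_ig(x)=\tfrac12\big(g(x^{i\to0})-g(x^{i\to1})\big)$ (where $x^{i\to b}$ is $x$ with the $i$-th bit replaced by $b$), $\mathbf I[g]=\sum_{i=1}^n\mathbb E_x[(D_ig(x))^2]$ for the total influence, and $$p(f)=\Pr_{x,i}\big[(x_i=0\wedge f(x)=1\wedge f(x+e_i)=0)\vee(x_i=1\wedge f(x)=0\wedge f(x+e_i)=1)\big]$$ ($x\in\{0,1\}^n$ and $i\in\{1,\dots,n\}$ uniform) for the pair-violation probability. Given $\varepsilon,\delta\in(0,1)$, put $m_2=\big\lceil \frac{n^2\ln(6/\delta)}{2(\varepsilon/3)^2}\big\rceil$,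 $m_1=\max\{3m_2,\lceil 18\ln(6/\delta)\rceil\}$, $m_5=\big\lceil\frac{4\ln(6n/\delta)}{(\varepsilon/3n)^2}\big\rceil$, and consider the following algorithm. 1. Use $m_1$ copies of $|f\rangle$, one at a time: apply a Hadamard gate to each of the $n+1$ qubits and measure the last qubit; if the outcome is $1$, measure the first $n$ qubits and record the result as a set $S\subseteq\{1,\dots,n\}$. Let $\hat{\mathbf I}$ be $1/m_2$ times the sum of $|S|$ over the first $m_2$ recorded sets (over all recorded sets, if there are fewer than $m_2$). 2. Measure $m_5$ further copies of $|f\rangle$ in the computational basis to obtain classical samples $(x_k,f(x_k))$, and put $\tilde g_i=\frac1{m_5}\sum_{k=1}^{m_5}(-1)^{(x_k)_i+f(x_k)}$ for $1\le i\le n$. 3. Put $\hat p=\frac1{2n}\hat{\mathbf I}-\frac1{2n}\sum_{i=1}^n\tilde g_i$. If $\hat p\le\varepsilon/3n$, accept; if $\hat p\ge 2\varepsilon/3n$ (and $\hat p>\varepsilon/3n$), reject; otherwise output nothing. **Theorem.** (a) For all $n\ge1$ and $f:\{0,1\}^n\to\{0,1\}$, $$p(f)=\frac{1}{2n}\Big(\mathbf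 I[g]-\sum_{i=1}^n\hat g(\{i\})\Big).$$ (b) There is an absolute constant $C>0$ such that for all $n\ge1$, $f:\{0,1\}^n\to\{0,1\}$ and $\varepsilon,\delta\in(0,1)$ the following hold. * The algorithm always uses exactly $m=m_1+m_5$ copies of $|f\rangle$, and $m\le C\,\dfrac{n^2\,(1+\ln n+\ln(1/\delta))}{\varepsilon^2}$. In particular $m=\tilde{\mathcal O}\big(n^2\log(1/\delta)/\varepsilon^2\big)$, where the tilde hides a factor logarithmic in $n$: if $\delta\le\frac12$ then $m\le C\,\dfrac{n^2(1+\ln n)\ln(1/\delta)}{\varepsilon^2}$. * The algorithm is efficient: carried out by one fixed program, independent of $n,\varepsilon,\delta$ and $f$, on a random access machine with a register of $n+1$ qubits, it always halts after at most $C\,\dfrac{n^3\,(1+\ln n+\ln(1/\delta))}{\varepsilon^2}$ elementary operations. Elementary operations are Hadamard, $T$ and controlled-NOT gates, measurements of single qubits in the computational basis, and classical operations on real numbers (arithmetic, comparison, logarithm, rounding up, memory access, loop control); loading a copy of $|f\rangle$ into the register costs $n+2$ operations. * With probability at least $1-\delta$ all of the following hold: if $f$ is monotone, the algorithm accepts;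 if $f$ is $\varepsilon$-far from monotone, the algorithm rejects; $|\hat{\mathbf I}-\mathbf I[g]|\le\varepsilon/3$; $|\tilde g_i-\hat g(\{i\})|\le\varepsilon/3n$ for all $i$; and $|\hat p-p(f)|\le\varepsilon/3n$. -/

import Mathlib

open scoped NNReal

namespace QTest

/-! ## Boolean functions, distance to monotonicity, Fourier analysis

Bits are `Bool` with `false < true`, so `Monotone f` for `f : (Fin n → Bool) → Bool` is
monotonicity for the coordinatewise order on the hypercube. -/

/-- `Pr_x [f x ≠ g x]` for uniformly random `x`. -/
noncomputable def relDist {n : ℕ} (f g : (Fin n → Bool) → Bool) : ℝ :=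
  ((Finset.univ.filter fun x => f x ≠ g x).card : ℝ) / 2 ^ n

/-- `f` is `ε`-far from all monotone functions. -/
def FarFromMonotone {n : ℕ} (ε : ℝ) (f : (Fin n → Bool) → Bool) : Prop :=
  ∀ g : (Fin n → Bool) → Bool, Monotone g → ε ≤ relDist f g

/-- The string `x + e_i`. -/
def flipBit {n : ℕ} (x : Fin n → Bool) (i : Fin n) : Fin n → Bool :=
  Function.update x i (!x i)

/-- The pair `x, x + e_i` violates monotonicity of `f`. -/
def Violates {n : ℕ} (f : (Fin n → Bool) → Bool) (x : Fin n → Bool) (i : Fin n) : Prop :=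
  (x i = false ∧ f x = true ∧ f (flipBit x i) = false) ∨
    (x i = true ∧ f x = false ∧ f (flipBit x i) = true)

open Classical in
/-- The probability that `x, x + e_i` violates monotonicity, for uniformly random `x` and `i`. -/
noncomputable def violationProb {n : ℕ} (f : (Fin n → Bool) → Bool) : ℝ :=
  ((Finset.univ.filter fun p : (Fin n → Bool) × Fin n => Violates f p.1 p.2).card : ℝ) /
    (2 ^ n * n)

/-- `g = (-1)^f`. -/
def signFn {n : ℕ} (f : (Fin n → Bool) → Bool) (x : Fin n → Bool) : ℝ :=
  if f x then -1 else 1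

/-- Expectation over a uniformly random point of the hypercube. -/
noncomputable def cubeExp {n : ℕ} (h : (Fin n → Bool) → ℝ) : ℝ :=
  (∑ x, h x) / 2 ^ n

/-- The Fourier coefficient `E_x [g(x) χ_S(x)]`, where `χ_S(x) = ∏_{i ∈ S} (-1)^{x_i}`. -/
noncomputable def cubeFourier {n : ℕ} (g : (Fin n → Bool) → ℝ) (S : Finset (Fin n)) : ℝ :=
  cubeExp fun x => g x * ∏ i ∈ S, (if x i then (-1 : ℝ) else 1)

/-- The `i`-th derivative; the bit `false` is the sign `+1` and the bit `true` is the sign `-1`. -/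
noncomputable def cubeDeriv {n : ℕ} (i : Fin n) (g : (Fin n → Bool) → ℝ) (x : Fin n → Bool) : ℝ :=
  (g (Function.update x i false) - g (Function.update x i true)) / 2

/-- The influence `Inf_i[g] = E_x [(D_i g(x))^2]`. -/
noncomputable def influence {n : ℕ} (i : Fin n) (g : (Fin n → Bool) → ℝ) : ℝ :=
  cubeExp fun x => cubeDeriv i g x ^ 2

/-- The total influence `I[g]`. -/
noncomputable def totalInfluence {n : ℕ} (g : (Fin n → Bool) → ℝ) : ℝ :=
  ∑ i, influence i g

/-! ## A register of `n + 1` qubits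

A (pure) state is a nonzero amplitude vector, considered up to normalisation. Qubits are numbered
`0, …, n`. Gates and measurements addressing a nonexistent qubit do nothing. -/

/-- Amplitude vectors of `n + 1` qubits. -/
abbrev Amp (n : ℕ) : Type := (Fin (n + 1) → Bool) → ℂ

/-- The function state `2^{-n/2} ∑_x |x, f(x)⟩`; qubits `0, …, n-1` hold `x`, qubit `n` holds
`f(x)`. -/
noncomputable def functionState {n : ℕ} (f : (Fin n → Bool) → Bool) : Amp n :=
  fun z => if z (Fin.last n) = f (fun i => z i.castSucc) then ((1 / √(2 ^ n) : ℝ) : ℂ) else 0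

/-- The Hadamard gate on qubit `q`. -/
noncomputable def gateH {n : ℕ} (q : ℕ) (ψ : Amp n) : Amp n :=
  if h : q < n + 1 then
    fun z => (ψ (Function.update z ⟨q, h⟩ false) +
      (if z ⟨q, h⟩ then -1 else 1) * ψ (Function.update z ⟨q, h⟩ true)) / ((√2 : ℝ) : ℂ)
  else ψ

/-- The `T` gate (`diag(1, e^{iπ/4})`) on qubit `q`. -/
noncomputable def gateT {n : ℕ} (q : ℕ) (ψ : Amp n) : Amp n :=
  if h : q < n + 1 then
    fun z => (if z ⟨q, h⟩ then Complex.exp (Complex.I * (Real.pi / 4 : ℝ)) else 1) * ψ z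
  else ψ

/-- The controlled-NOT gate with control `q` and target `t ≠ q`. -/
noncomputable def gateCNOT {n : ℕ} (q t : ℕ) (ψ : Amp n) : Amp n :=
  if h : q < n + 1 ∧ t < n + 1 ∧ q ≠ t then
    fun z => ψ (Function.update z ⟨t, h.2.1⟩ (xor (z ⟨t, h.2.1⟩) (z ⟨q, h.1⟩)))
  else ψ

/-- The projection of `ψ` to the subspace on which qubit `q` has the value `b`. -/
noncomputable def project {n : ℕ} (q : Fin (n + 1)) (b : Bool) (ψ : Amp n) : Amp n :=
  fun z => if z q = b then ψ z else 0

/-- The squared norm of an amplitude vector. -/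
noncomputable def sqNorm {n : ℕ} (ψ : Amp n) : ℝ≥0 := ∑ z, ‖ψ z‖₊ ^ 2

/-- Born's rule: the probability of the outcome `true` when qubit `q` is measured. -/
noncomputable def bornProb {n : ℕ} (q : Fin (n + 1)) (ψ : Amp n) : ℝ≥0 :=
  sqNorm (project q true ψ) / sqNorm ψ

theorem bornProb_le_one {n : ℕ} (q : Fin (n + 1)) (ψ : Amp n) : bornProb q ψ ≤ 1 := by
  refine div_le_one_of_le₀ ?_ zero_le
  refine Finset.sum_le_sum fun z _ => ?_
  unfold project
  split_ifs <;> simp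

/-- The distribution of the outcome when qubit `q` is measured in the computational basis. -/
noncomputable def bornPMF {n : ℕ} (q : Fin (n + 1)) (ψ : Amp n) : PMF Bool :=
  PMF.ofFintype (fun b => ((if b then bornProb q ψ else 1 - bornProb q ψ : ℝ≥0) : ENNReal)) (by
    rw [Fintype.sum_bool, ← ENNReal.coe_add]
    simp [bornProb_le_one q ψ])

/-! ## A random access machine with a quantum register

Classical memory: named scalar variables and one array, holding real numbers. Quantum memory:
`n + 1` qubits. The machine can load a fresh copy of the function state (discarding the previous
contents of the quantum register), apply the gates `H`, `T`, `CNOT` to single qubits (pairs of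
qubits), measure single qubits, and do elementary classical operations. Programs are finite and do
not depend on `n`. Loops are bounded, so every program halts. -/

/-- Names of scalar variables. -/
inductive Var
  | n | eps | delta
  | eps2 | eps5 | delta1 | delta2 | delta5 | m1 | m2 | m5
  | ell | i | bit | label | weight | found | total
  | Ihat | gsum | phat
  deriving DecidableEq

/-- Classical expressions. -/
inductive CExpr
  | const (k : ℕ)
  | var (v : Var)
  | arr (idx : CExpr)
  | add (a b : CExpr)
  | sub (a b : CExpr)
  | mul (a b : CExpr)
  | div (a b : CExpr)
  | log (a : CExpr)
  | ceil (a : CExpr)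

instance : Coe Var CExpr := ⟨CExpr.var⟩
instance (k : ℕ) : OfNat CExpr k := ⟨CExpr.const k⟩
instance : Add CExpr := ⟨CExpr.add⟩
instance : Sub CExpr := ⟨CExpr.sub⟩
instance : Mul CExpr := ⟨CExpr.mul⟩
instance : Div CExpr := ⟨CExpr.div⟩

/-- The number of elementary operations needed to evaluate an expression: one for every constant,
memory access, arithmetic operation, logarithm and rounding. -/
def CExpr.cost : CExpr → ℕ
  | const _ => 1
  | var _ => 1
  | arr a => a.cost + 1
  | add a b => a.cost + b.cost + 1
  | sub a b => a.cost + b.cost + 1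
  | mul a b => a.cost + b.cost + 1
  | div a b => a.cost + b.cost + 1
  | log a => a.cost + 1
  | ceil a => a.cost + 1

/-- The value of an expression. -/
noncomputable def CExpr.eval (reg : Var → ℝ) (mem : ℕ → ℝ) : CExpr → ℝ
  | const k => k
  | var v => reg v
  | arr a => mem ⌊a.eval reg mem⌋₊
  | add a b => a.eval reg mem + b.eval reg mem
  | sub a b => a.eval reg mem - b.eval reg mem
  | mul a b => a.eval reg mem * b.eval reg mem
  | div a b => a.eval reg mem / b.eval reg mem
  | log a => Real.log (a.eval reg mem)
  | ceil a => (⌈a.eval reg mem⌉ : ℝ)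

/-- Programs. -/
inductive Prog
  /-- do nothing -/
  | skip
  /-- `v := e` -/
  | assign (v : Var) (e : CExpr)
  /-- `mem[idx] := e` -/
  | store (idx e : CExpr)
  /-- run one program after the other -/
  | seq (p q : Prog)
  /-- if `a ≤ b` then `p` else `q` -/
  | ifLE (a b : CExpr) (p q : Prog)
  /-- for `v = 0, 1, …, e - 1` run `p` -/
  | loop (v : Var) (e : CExpr) (p : Prog)
  /-- load a fresh copy of the function state into the quantum register -/
  | fresh
  /-- apply a Hadamard gate -/
  | had (q : CExpr)
  /-- apply a `T` gate -/
  | tgate (q : CExpr)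
  /-- apply a controlled-NOT gate -/
  | cnot (q t : CExpr)
  /-- measure a qubit and write the outcome (`0` or `1`) to `v` -/
  | meas (q : CExpr) (v : Var)
  /-- output `true` (accept) or `false` (reject) -/
  | answer (b : Bool)

infixr:50 ";; " => Prog.seq

/-- A configuration of the machine, together with counters for the elementary operations performed
and the copies of the function state used so far. -/
structure Config (n : ℕ) where
  reg : Var → ℝ
  mem : ℕ → ℝ
  psi : Amp n
  out : Option Bool
  steps : ℕ
  copies : ℕ

namespace Config

variable {n : ℕ}

/-- Add `k` elementary operations to the counter. -/
def tick (c : Config n) (k : ℕ) : Config n := { c with steps := c.steps + k }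

/-- Overwrite a scalar variable. -/
def set (c : Config n) (v : Var) (r : ℝ) : Config n := { c with reg := Function.update c.reg v r }

/-- The value of an expression. -/
noncomputable def val (c : Config n) (e : CExpr) : ℝ := e.eval c.reg c.mem

/-- The value of an expression that is used as an index or as a loop bound. -/
noncomputable def idx (c : Config n) (e : CExpr) : ℕ := ⌊c.val e⌋₊

/-- Measure qubit `q` and write the outcome to `v`. -/
noncomputable def measure (c : Config n) (q : ℕ) (v : Var) : PMF (Config n) :=
  if h : q < n + 1 then
    (bornPMF ⟨q, h⟩ c.psi).map fun b =>
      { c.set v (if b then 1 else 0) with psi := project ⟨q, h⟩ b c.psi }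
  else PMF.pure c

end Config

/-- Run `body 0`, `body 1`, …, `body (k - 1)` one after the other. -/
noncomputable def iterateM {α : Type} (body : ℕ → α → PMF α) : ℕ → α → PMF α
  | 0, c => PMF.pure c
  | k + 1, c => (iterateM body k c).bind (body k)

/-- The distribution of the final configuration when a program is run with access to copies of the
function state of `f`. Every instruction costs one elementary operation plus the cost of evaluating
its expressions; every pass through a loop costs one more operation, and loading a copy of the
function state costs one operation for each of its `n + 1` qubits. -/
noncomputable def Prog.exec {n : ℕ} (f : (Fin n → Bool) → Bool) :
    Prog → Config n → PMF (Config n)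
  | skip, c => PMF.pure (c.tick 1)
  | assign v e, c => PMF.pure ((c.set v (c.val e)).tick (1 + e.cost))
  | store a e, c =>
      PMF.pure { c.tick (1 + a.cost + e.cost) with
        mem := Function.update c.mem (c.idx a) (c.val e) }
  | seq p q, c => (exec f p c).bind fun c' => exec f q c'
  | ifLE a b p q, c =>
      open Classical in
      if c.val a ≤ c.val b then exec f p (c.tick (1 + a.cost + b.cost))
      else exec f q (c.tick (1 + a.cost + b.cost))
  | loop v e p, c =>
      iterateM (fun k c' => exec f p ((c'.set v k).tick 1)) (c.idx e) (c.tick (1 + e.cost))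
  | fresh, c =>
      PMF.pure { c.tick (1 + (n + 1)) with psi := functionState f, copies := c.copies + 1 }
  | had q, c => PMF.pure { c.tick (1 + q.cost) with psi := gateH (c.idx q) c.psi }
  | tgate q, c => PMF.pure { c.tick (1 + q.cost) with psi := gateT (c.idx q) c.psi }
  | cnot q t, c =>
      PMF.pure { c.tick (1 + q.cost + t.cost) with psi := gateCNOT (c.idx q) (c.idx t) c.psi }
  | meas q v, c => (c.tick (1 + q.cost)).measure (c.idx q) v
  | answer b, c => PMF.pure { c.tick 1 with out := some b }

/-! ## The monotonicity tester -/

open Prog CExpr in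
/-- Parameters: `ε₂ = ε/3`, `ε₅ = ε/(3n)`, `δ₁ = δ₂ = δ/3`, `δ₅ = δ/(3n)` and the sample sizes. -/
def initialization : Prog :=
  assign .eps2 (Var.eps / 3);;
  assign .eps5 (Var.eps / (3 * Var.n));;
  assign .delta1 (Var.delta / 3);;
  assign .delta2 (Var.delta / 3);;
  assign .delta5 (Var.delta / (3 * Var.n));;
  assign .m2 (ceil (Var.n * Var.n * log (2 / Var.delta2) / (2 * (Var.eps2 * Var.eps2))));;
  assign .m1 (ceil (18 * log (2 / Var.delta1)));;
  ifLE Var.m1 (3 * Var.m2) (assign .m1 (3 * Var.m2)) skip;;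
  assign .m5 (ceil (4 * log (2 / Var.delta5) / (Var.eps5 * Var.eps5)))

open Prog CExpr in
/-- One attempt at Fourier sampling: apply `H` to all `n + 1` qubits of a copy and measure the last
qubit. If the outcome is `1`, the other `n` qubits are measured, which gives the indicator string of
a set `S`; if fewer than `m2` sets were found before, `|S|` is added to `total`. -/
def fourierAttempt : Prog :=
  fresh;;
  loop .i (Var.n + 1) (had Var.i);;
  meas Var.n .label;;
  ifLE 1 Var.label
    (assign .weight 0;;
      loop .i Var.n (meas Var.i .bit;; assign .weight (Var.weight + Var.bit));;
      ifLE (Var.found + 1) Var.m2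
        (assign .total (Var.total + Var.weight);; assign .found (Var.found + 1))
        skip)
    skip

open Prog CExpr in
/-- One classical sample `(x, f(x))`, obtained by measuring all qubits of a copy; the sign
`(-1)^{x_i + f(x)}` is added to `mem[i]` for every `i`. -/
def classicalSample : Prog :=
  fresh;;
  meas Var.n .label;;
  loop .i Var.n
    (meas Var.i .bit;;
      store Var.i (arr Var.i + (1 - 2 * Var.bit) * (1 - 2 * Var.label)))

open Prog CExpr in
/-- The tester. The estimate of the total influence is left in `Ihat`, the estimate of the `i`-th
degree-one Fourier coefficient in `mem[i]`, and the estimate of the violation probability in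
`phat`. -/
def tester : Prog :=
  initialization;;
  assign .found 0;;
  assign .total 0;;
  loop .ell Var.m1 fourierAttempt;;
  assign .Ihat (Var.total / Var.m2);;
  loop .i Var.n (store Var.i 0);;
  loop .ell Var.m5 classicalSample;;
  loop .i Var.n (store Var.i (arr Var.i / Var.m5));;
  assign .gsum 0;;
  loop .i Var.n (assign .gsum (Var.gsum + arr Var.i));;
  assign .phat (Var.Ihat / (2 * Var.n) - Var.gsum / (2 * Var.n));;
  ifLE Var.phat (Var.eps / (3 * Var.n))
    (answer true)
    (ifLE (2 * Var.eps / (3 * Var.n)) Var.phat (answer false) skip)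

/-- The initial configuration: the inputs `n`, `ε`, `δ`, all other variables `0`, and the qubits in
the state `|0…0⟩`. -/
noncomputable def initConfig (n : ℕ) (ε δ : ℝ) : Config n where
  reg := fun v => match v with
    | .n => n
    | .eps => ε
    | .delta => δ
    | _ => 0
  mem := fun _ => 0
  psi := Pi.single (fun _ => false) 1
  out := none
  steps := 0
  copies := 0

/-- The distribution of the final configuration of the tester. -/
noncomputable def runTester {n : ℕ} (f : (Fin n → Bool) → Bool) (ε δ : ℝ) : PMF (Config n) :=
  tester.exec f (initConfig n ε δ)

/-- The number of copies of the function state that the tester uses,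
`max {3 m₂, ⌈18 ln(2/δ₁)⌉} + m₅`. -/
noncomputable def copyCount (n : ℕ) (ε δ : ℝ) : ℕ :=
  max (3 * ⌈(n : ℝ) ^ 2 * Real.log (2 / (δ / 3)) / (2 * (ε / 3) ^ 2)⌉₊)
      ⌈18 * Real.log (2 / (δ / 3))⌉₊ +
    ⌈4 * Real.log (2 / (δ / (3 * n))) / (ε / (3 * n)) ^ 2⌉₊

end QTest

open QTest

/-!
The derivative `D_i g` is `-1` on the violated edges in direction `i` and `0` or `1` elsewhere, so
`((D_i g)² - D_i g) / 2` is their indicator. Averaging over `x` and `i` gives (a).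

Sorting `f` along the edges of one direction after another yields a monotone function. Sorting along
direction `i` changes `f` only at the endpoints of the violated edges in direction `i`, and it does
not increase the number of violated edges in any other direction. Hence the distance of `f` to
monotone functions is at most `n · p(f)`, and `p(f) ≥ ε / n` if `f` is `ε`-far from monotone.

After the Hadamard gates the last qubit is measured as `1` with probability `1/2`, and then the
first `n` qubits show `S` with probability `ĝ(S)²`, so that `E|S| = I[g]` by Parseval. The
exponential moments of the two sampling loops are controlled step by step: if one pass multiplies
the expectation of a potential by at most a constant, then `k` passes do so by at most its `k`-th
power, and Markov's inequality turns this into the Chernoff and Hoeffding bounds. A union bound over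
the estimates gives the total error probability.
-/

namespace QTest

/-! ## Fourier analysis on the cube -/

section Fourier

variable {n : ℕ}

theorem update_eq_self_of_apply_eq {x : Fin n → Bool} {i : Fin n} {b : Bool} (h : x i = b) :
    Function.update x i b = x :=
  Function.update_eq_self_iff.mpr h.symm

theorem flipBit_flipBit (x : Fin n → Bool) (i : Fin n) : flipBit (flipBit x i) i = x := by
  simp [flipBit]

theorem sum_flipBit {M : Type*} [AddCommMonoid M] (i : Fin n) (h : (Fin n → Bool) → M) :
    ∑ x, h (flipBit x i) = ∑ x, h x :=
  Equiv.sum_comp (Function.Involutive.toPerm _ fun x => flipBit_flipBit x i) h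

theorem add_flipBit {M : Type*} [AddCommMonoid M] (i : Fin n) (h : (Fin n → Bool) → M)
    (x : Fin n → Bool) :
    h x + h (flipBit x i) = h (Function.update x i false) + h (Function.update x i true) := by
  cases hx : x i
  · rw [update_eq_self_of_apply_eq hx, flipBit, hx, Bool.not_false]
  · rw [update_eq_self_of_apply_eq hx, flipBit, hx, Bool.not_true, add_comm]

theorem sum_update_false_add_update_true {M : Type*} [AddCommMonoid M] (i : Fin n)
    (h : (Fin n → Bool) → M) :
    ∑ x, (h (Function.update x i false) + h (Function.update x i true)) = 2 • ∑ x, h x := by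
  simp_rw [← add_flipBit, Finset.sum_add_distrib, sum_flipBit i h, two_nsmul]

/-- The sign `(-1)^b` of a bit. -/
def bitSign (b : Bool) : ℝ := if b then -1 else 1

@[simp] theorem bitSign_true : bitSign true = -1 := rfl

@[simp] theorem bitSign_false : bitSign false = 1 := rfl

theorem bitSign_mul_self (b : Bool) : bitSign b * bitSign b = 1 := by cases b <;> simp

theorem bitSign_not (b : Bool) : bitSign (!b) = -bitSign b := by cases b <;> simp

theorem one_add_bitSign_mul_bitSign (a b : Bool) :
    1 + bitSign a * bitSign b = if a = b then 2 else 0 := by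
  cases a <;> cases b <;> norm_num

/-- The character `χ_S(x) = ∏_{i ∈ S} (-1)^{x_i}` of the cube. -/
def walsh (S : Finset (Fin n)) (x : Fin n → Bool) : ℝ := ∏ i ∈ S, bitSign (x i)

theorem cubeFourier_eq (g : (Fin n → Bool) → ℝ) (S : Finset (Fin n)) :
    cubeFourier g S = (∑ x, g x * walsh S x) / 2 ^ n := rfl

theorem cubeFourier_singleton (g : (Fin n → Bool) → ℝ) (i : Fin n) :
    cubeFourier g {i} = cubeExp fun x => g x * bitSign (x i) := by
  simp only [cubeFourier, Finset.prod_singleton, bitSign]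

theorem sum_walsh_mul_walsh (x y : Fin n → Bool) :
    ∑ S, walsh S x * walsh S y = if x = y then 2 ^ n else 0 := by
  calc ∑ S, walsh S x * walsh S y = ∏ i, (1 + bitSign (x i) * bitSign (y i)) := by
        simp_rw [walsh, Finset.prod_one_add, Finset.powerset_univ, Finset.prod_mul_distrib]
    _ = if x = y then 2 ^ n else 0 := by
        simp [one_add_bitSign_mul_bitSign, Finset.prod_ite_zero, funext_iff]

theorem parseval (g : (Fin n → Bool) → ℝ) :
    ∑ S, cubeFourier g S ^ 2 = cubeExp fun x => g x ^ 2 := by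
  calc ∑ S, cubeFourier g S ^ 2
      = (∑ S, ∑ x, ∑ y, g x * g y * (walsh S x * walsh S y)) / (2 ^ n) ^ 2 := by
        simp_rw [cubeFourier_eq, div_pow, sq (∑ _, _), Finset.sum_mul_sum, ← Finset.sum_div,
          mul_mul_mul_comm]
    _ = (∑ x, ∑ y, g x * g y * ∑ S, walsh S x * walsh S y) / (2 ^ n) ^ 2 := by
        simp_rw [Finset.mul_sum, Finset.sum_comm (s := (Finset.univ : Finset (Finset (Fin n))))]
    _ = (∑ x, g x ^ 2) / 2 ^ n := by
        simp_rw [sum_walsh_mul_walsh, mul_ite, mul_zero, Finset.sum_ite_eq, Finset.mem_univ,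
          if_true, ← Finset.sum_mul, ← sq]
        field_simp

theorem walsh_flipBit (S : Finset (Fin n)) (x : Fin n → Bool) (i : Fin n) :
    walsh S (flipBit x i) = (if i ∈ S then -1 else 1) * walsh S x := by
  have hbit : ∀ j, bitSign (flipBit x i j) = (if j = i then -1 else 1) * bitSign (x j) := by
    intro j
    rcases eq_or_ne j i with rfl | hj
    · simp [flipBit, bitSign_not]
    · simp [flipBit, hj]
  simp_rw [walsh, hbit, Finset.prod_mul_distrib, Finset.prod_ite_eq']

theorem cubeDeriv_sq (i : Fin n) (g : (Fin n → Bool) → ℝ) (x : Fin n → Bool) :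
    cubeDeriv i g x ^ 2 = ((g x - g (flipBit x i)) / 2) ^ 2 := by
  rw [cubeDeriv, flipBit]
  cases hx : x i
  · rw [update_eq_self_of_apply_eq hx, Bool.not_false]
  · rw [update_eq_self_of_apply_eq hx, Bool.not_true]
    ring

theorem cubeFourier_sub_flipBit (i : Fin n) (g : (Fin n → Bool) → ℝ) (S : Finset (Fin n)) :
    cubeFourier (fun x => (g x - g (flipBit x i)) / 2) S =
      if i ∈ S then cubeFourier g S else 0 := by
  have hflip : ∑ x, g (flipBit x i) * walsh S x =
      (if i ∈ S then -1 else 1) * ∑ x, g x * walsh S x := by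
    rw [← sum_flipBit i, Finset.mul_sum]
    refine Finset.sum_congr rfl fun x _ => ?_
    rw [flipBit_flipBit, walsh_flipBit]
    ring
  simp_rw [cubeFourier_eq, div_mul_eq_mul_div, sub_mul, ← Finset.sum_div, Finset.sum_sub_distrib,
    hflip]
  split_ifs <;> ring

theorem influence_eq (i : Fin n) (g : (Fin n → Bool) → ℝ) :
    influence i g = ∑ S, if i ∈ S then cubeFourier g S ^ 2 else 0 := by
  simp_rw [influence, cubeDeriv_sq, ← parseval, cubeFourier_sub_flipBit, ite_pow,
    zero_pow two_ne_zero]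

theorem sum_cubeFourier_sq_mul_card (g : (Fin n → Bool) → ℝ) :
    ∑ S, cubeFourier g S ^ 2 * (S.card : ℝ) = totalInfluence g := by
  simp_rw [totalInfluence, influence_eq]
  rw [Finset.sum_comm]
  refine Finset.sum_congr rfl fun S _ => ?_
  rw [Finset.sum_ite_mem, Finset.univ_inter, Finset.sum_const, nsmul_eq_mul, mul_comm]

theorem signFn_eq (f : (Fin n → Bool) → Bool) (x : Fin n → Bool) :
    signFn f x = bitSign (f x) := rfl

theorem sum_cubeFourier_signFn_sq (f : (Fin n → Bool) → Bool) :
    ∑ S, cubeFourier (signFn f) S ^ 2 = 1 := by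
  rw [parseval, cubeExp]
  simp [signFn_eq, sq, bitSign_mul_self]

end Fourier

/-! ## Violated edges -/

section Violations

variable {n : ℕ} {f : (Fin n → Bool) → Bool}

theorem violates_iff (x : Fin n → Bool) (i : Fin n) :
    Violates f x i ↔
      f (Function.update x i false) = true ∧ f (Function.update x i true) = false := by
  rw [Violates, flipBit]
  cases hx : x i
  · simp [update_eq_self_of_apply_eq hx]
  · simp [update_eq_self_of_apply_eq hx, and_comm]

theorem not_violates_iff (x : Fin n → Bool) (i : Fin n) :
    ¬ Violates f x i ↔ f (Function.update x i false) ≤ f (Function.update x i true) := by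
  rw [violates_iff]
  cases f (Function.update x i false) <;> cases f (Function.update x i true) <;> simp

open Classical in
/-- The number of points `x` for which the pair `x, x + e_i` violates monotonicity; every violated
edge in direction `i` is counted twice. -/
noncomputable def violations (f : (Fin n → Bool) → Bool) (i : Fin n) : ℕ :=
  (Finset.univ.filter fun x => Violates f x i).card

theorem violations_eq_zero_iff {i : Fin n} :
    violations f i = 0 ↔
      ∀ x, f (Function.update x i false) ≤ f (Function.update x i true) := by
  simp [violations, Finset.filter_eq_empty_iff, not_violates_iff]

theorem monotone_iff_violations_eq_zero : Monotone f ↔ ∀ i, violations f i = 0 := by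
  classical
  let _ : LocallyFiniteOrder (Fin n → Bool) := Fintype.toLocallyFiniteOrder
  simp_rw [violations_eq_zero_iff]
  refine ⟨fun hf i x => hf (update_le_update_iff.mpr ⟨Bool.false_le true, fun _ _ => le_rfl⟩),
    fun hf => (monotone_iff_forall_covBy f).mpr fun x y hxy => ?_⟩
  obtain ⟨i, b, hb, rfl⟩ := Pi.covBy_iff_exists_right_eq.mp hxy
  obtain ⟨hx, rfl⟩ := Bool.lt_iff.mp hb.lt
  simpa only [update_eq_self_of_apply_eq hx] using hf i x

theorem violationProb_eq (f : (Fin n → Bool) → Bool) :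
    violationProb f = (∑ i, (violations f i : ℝ)) / (2 ^ n * n) := by
  classical
  simp_rw [violationProb, violations, Finset.card_filter]
  rw [Fintype.sum_prod_type, Finset.sum_comm]
  push_cast
  rfl

theorem violationProb_of_monotone (hf : Monotone f) : violationProb f = 0 := by
  simp [violationProb_eq, monotone_iff_violations_eq_zero.mp hf]

theorem cubeFourier_singleton_eq_cubeExp_cubeDeriv (g : (Fin n → Bool) → ℝ) (i : Fin n) :
    cubeFourier g {i} = cubeExp (cubeDeriv i g) := by
  have h := sum_update_false_add_update_true i fun x => g x * bitSign (x i)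
  simp only [Function.update_self, bitSign_false, bitSign_true, mul_one, mul_neg, nsmul_eq_mul,
    Nat.cast_ofNat, ← sub_eq_add_neg] at h
  simp_rw [cubeFourier_singleton, cubeExp, cubeDeriv, ← Finset.sum_div, h]
  ring

theorem two_mul_violations (f : (Fin n → Bool) → Bool) (i : Fin n) :
    2 * (violations f i : ℝ) =
      2 ^ n * (influence i (signFn f) - cubeFourier (signFn f) {i}) := by
  classical
  rw [cubeFourier_singleton_eq_cubeExp_cubeDeriv, influence, cubeExp, cubeExp, ← sub_div,
    ← Finset.sum_sub_distrib, mul_div_cancel₀ _ (by positivity), violations, Finset.card_filter,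
    Nat.cast_sum, Finset.mul_sum]
  refine Finset.sum_congr rfl fun x _ => ?_
  simp only [violates_iff, cubeDeriv, signFn_eq]
  cases f (Function.update x i false) <;> cases f (Function.update x i true) <;> norm_num

theorem violationProb_eq_fourier (f : (Fin n → Bool) → Bool) :
    violationProb f =
      (totalInfluence (signFn f) - ∑ i, cubeFourier (signFn f) {i}) / (2 * n) := by
  have h : 2 * ∑ i, (violations f i : ℝ) =
      2 ^ n * (totalInfluence (signFn f) - ∑ i, cubeFourier (signFn f) {i}) := by
    rw [totalInfluence, ← Finset.sum_sub_distrib, Finset.mul_sum, Finset.mul_sum]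
    exact Finset.sum_congr rfl fun i _ => two_mul_violations f i
  rw [violationProb_eq, ← mul_div_mul_left _ _ (two_ne_zero (α := ℝ)), h, mul_left_comm,
    mul_div_mul_left _ _ (by positivity)]

end Violations

/-! ## Distance to monotonicity -/

section Distance

variable {n : ℕ}

/-- The result of sorting the two values of `f` on every edge in direction `i`. -/
def sortDir (i : Fin n) (f : (Fin n → Bool) → Bool) (x : Fin n → Bool) : Bool :=
  if x i then f (Function.update x i false) || f (Function.update x i true)
  else f (Function.update x i false) && f (Function.update x i true)

theorem sortDir_ne_iff (i : Fin n) (f : (Fin n → Bool) → Bool) (x : Fin n → Bool) :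
    f x ≠ sortDir i f x ↔ Violates f x i := by
  rw [violates_iff, sortDir]
  cases hx : x i
  · rw [update_eq_self_of_apply_eq hx]
    cases f x <;> cases f (Function.update x i true) <;> simp
  · rw [update_eq_self_of_apply_eq hx]
    cases f x <;> cases f (Function.update x i false) <;> simp

theorem hammingDist_sortDir (i : Fin n) (f : (Fin n → Bool) → Bool) :
    hammingDist f (sortDir i f) = violations f i := by
  classical
  simp only [hammingDist, violations, sortDir_ne_iff]

theorem violations_sortDir_self (i : Fin n) (f : (Fin n → Bool) → Bool) :
    violations (sortDir i f) i = 0 := by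
  rw [violations_eq_zero_iff]
  intro x
  simp only [sortDir, Function.update_self, Function.update_idem]
  cases f (Function.update x i false) <;> cases f (Function.update x i true) <;> simp

/- It suffices to check this on each square spanned by the directions `i` and `j`. -/
theorem violations_sortDir_le (i j : Fin n) (f : (Fin n → Bool) → Bool) :
    violations (sortDir i f) j ≤ violations f j := by
  classical
  rcases eq_or_ne j i with rfl | hij
  · simp [violations_sortDir_self]
  simp_rw [violations, Finset.card_filter]
  refine le_of_nsmul_le_nsmul_right two_ne_zero ?_
  rw [← sum_update_false_add_update_true i, ← sum_update_false_add_update_true i]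
  refine Finset.sum_le_sum fun x _ => ?_
  simp only [violates_iff, sortDir, Function.update_comm hij.symm, Function.update_self,
    Function.update_idem]
  generalize f (Function.update (Function.update x j false) i false) = a
  generalize f (Function.update (Function.update x j false) i true) = b
  generalize f (Function.update (Function.update x j true) i false) = c
  generalize f (Function.update (Function.update x j true) i true) = d
  revert a b c d
  decide

theorem exists_sorted_hammingDist_le (f : (Fin n → Bool) → Bool) (s : Finset (Fin n)) :
    ∃ h : (Fin n → Bool) → Bool, (∀ i ∈ s, violations h i = 0) ∧
      (∀ i, violations h i ≤ violations f i) ∧ hammingDist f h ≤ ∑ i ∈ s, violations f i := by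
  induction s using Finset.induction_on with
  | empty => exact ⟨f, by simp, fun _ => le_rfl, by simp⟩
  | insert i s hi ih =>
    obtain ⟨h, h_sorted, h_le, h_dist⟩ := ih
    refine ⟨sortDir i h, fun j hj => ?_, fun j => (violations_sortDir_le i j h).trans (h_le j), ?_⟩
    · rcases Finset.mem_insert.mp hj with rfl | hj
      · exact violations_sortDir_self _ _
      · exact Nat.le_zero.mp ((violations_sortDir_le i j h).trans (h_sorted j hj).le)
    · calc hammingDist f (sortDir i h)
          ≤ hammingDist f h + hammingDist h (sortDir i h) := hammingDist_triangle _ _ _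
        _ ≤ ∑ j ∈ s, violations f j + violations f i :=
            add_le_add h_dist ((hammingDist_sortDir i h).trans_le (h_le i))
        _ = ∑ j ∈ insert i s, violations f j := by rw [Finset.sum_insert hi, add_comm]

theorem exists_monotone_hammingDist_le (f : (Fin n → Bool) → Bool) :
    ∃ h : (Fin n → Bool) → Bool, Monotone h ∧ hammingDist f h ≤ ∑ i, violations f i := by
  obtain ⟨h, h_sorted, -, h_dist⟩ := exists_sorted_hammingDist_le f Finset.univ
  exact ⟨h, monotone_iff_violations_eq_zero.mpr fun i => h_sorted i (Finset.mem_univ i), h_dist⟩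

theorem FarFromMonotone.le_violationProb {ε : ℝ} {f : (Fin n → Bool) → Bool}
    (hf : FarFromMonotone ε f) : ε / n ≤ violationProb f := by
  obtain ⟨h, h_mono, h_dist⟩ := exists_monotone_hammingDist_le f
  rw [violationProb_eq, ← div_div]
  gcongr
  calc ε ≤ (hammingDist f h : ℝ) / 2 ^ n := hf h h_mono
    _ ≤ (∑ i, (violations f i : ℝ)) / 2 ^ n := by
        gcongr
        exact_mod_cast h_dist

end Distance

/-! ## Expectations and tail bounds -/

section Expectation

open scoped ENNReal

variable {α β : Type*} {μ : PMF α} {φ ψ : α → ℝ≥0∞} {s : Set α}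

/-- The expectation of a nonnegative function. -/
noncomputable def expect (μ : PMF α) (φ : α → ℝ≥0∞) : ℝ≥0∞ := ∑' a, μ a * φ a

theorem expect_eq_sum [Fintype α] (μ : PMF α) (φ : α → ℝ≥0∞) :
    expect μ φ = ∑ a, μ a * φ a :=
  tsum_fintype _

@[simp] theorem expect_pure (a : α) (φ : α → ℝ≥0∞) : expect (PMF.pure a) φ = φ a := by
  rw [expect, tsum_eq_single a fun b hb => by simp [PMF.pure_apply, hb]]
  simp [PMF.pure_apply]

theorem expect_bind (μ : PMF α) (κ : α → PMF β) (φ : β → ℝ≥0∞) :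
    expect (μ.bind κ) φ = expect μ fun a => expect (κ a) φ := by
  simp_rw [expect, PMF.bind_apply, ← ENNReal.tsum_mul_right, ← ENNReal.tsum_mul_left]
  rw [ENNReal.tsum_comm]
  simp_rw [mul_assoc]

theorem expect_map (μ : PMF α) (g : α → β) (φ : β → ℝ≥0∞) :
    expect (μ.map g) φ = expect μ fun a => φ (g a) := by
  simp [PMF.map, expect_bind]

theorem expect_mono (h : ∀ a ∈ μ.support, φ a ≤ ψ a) : expect μ φ ≤ expect μ ψ := by
  refine ENNReal.tsum_le_tsum fun a => ?_
  rcases eq_or_ne (μ a) 0 with ha | ha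
  · simp [ha]
  · exact mul_le_mul_right (h a ((PMF.mem_support_iff μ a).mpr ha)) _

theorem expect_congr (h : ∀ a ∈ μ.support, φ a = ψ a) : expect μ φ = expect μ ψ :=
  le_antisymm (expect_mono fun a ha => (h a ha).le) (expect_mono fun a ha => (h a ha).ge)

theorem expect_const_mul (μ : PMF α) (r : ℝ≥0∞) (φ : α → ℝ≥0∞) :
    (expect μ fun a => r * φ a) = r * expect μ φ := by
  simp_rw [expect, mul_left_comm, ENNReal.tsum_mul_left]

theorem expect_const (μ : PMF α) (r : ℝ≥0∞) : (expect μ fun _ => r) = r := by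
  rw [expect, ENNReal.tsum_mul_right, μ.tsum_coe, one_mul]

theorem toOuterMeasure_le_expect (h : ∀ a ∈ μ.support, a ∈ s → 1 ≤ φ a) :
    μ.toOuterMeasure s ≤ expect μ φ := by
  rw [PMF.toOuterMeasure_apply]
  refine ENNReal.tsum_le_tsum fun a => ?_
  by_cases ha : a ∈ s ∧ a ∈ μ.support
  · exact (Set.indicator_le_self _ _ _).trans (le_mul_of_one_le_right' (h a ha.2 ha.1))
  · have h_zero : s.indicator μ a = 0 := by
      simpa [Set.indicator_apply_eq_zero, PMF.mem_support_iff] using ha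
    exact h_zero.trans_le zero_le

theorem toOuterMeasure_le_one (μ : PMF α) (s : Set α) : μ.toOuterMeasure s ≤ 1 :=
  (toOuterMeasure_le_expect fun _ _ _ => le_rfl).trans_eq (expect_const μ 1)

theorem toOuterMeasure_eq_zero_iff : μ.toOuterMeasure s = 0 ↔ ∀ a ∈ μ.support, a ∉ s := by
  rw [PMF.toOuterMeasure_apply_eq_zero_iff, Set.disjoint_left]

theorem toOuterMeasure_bind_le {κ : α → PMF β} {s : Set α} {t : Set β} {r₁ r₂ : ℝ≥0∞}
    (hμ : μ.toOuterMeasure s ≤ r₁) (hκ : ∀ a ∉ s, (κ a).toOuterMeasure t ≤ r₂) :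
    (μ.bind κ).toOuterMeasure t ≤ r₁ + r₂ := by
  have h_split : ∀ a, μ a * (κ a).toOuterMeasure t ≤ s.indicator μ a + μ a * r₂ := by
    intro a
    by_cases ha : a ∈ s
    · rw [Set.indicator_of_mem ha]
      exact (mul_le_of_le_one_right' (toOuterMeasure_le_one _ _)).trans le_self_add
    · exact (mul_le_mul_right (hκ a ha) _).trans le_add_self
  calc (μ.bind κ).toOuterMeasure t
      ≤ ∑' a, (s.indicator μ a + μ a * r₂) := by
        rw [PMF.toOuterMeasure_bind_apply]
        exact ENNReal.tsum_le_tsum h_split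
    _ = μ.toOuterMeasure s + r₂ := by
        rw [ENNReal.tsum_add, ← PMF.toOuterMeasure_apply]
        congr 1
        exact expect_const μ r₂
    _ ≤ r₁ + r₂ := by gcongr

/-- The exponential function with values in `ℝ≥0∞`. -/
noncomputable def eexp (x : ℝ) : ℝ≥0∞ := ENNReal.ofReal (Real.exp x)

theorem eexp_add (x y : ℝ) : eexp (x + y) = eexp x * eexp y := by
  rw [eexp, Real.exp_add, ENNReal.ofReal_mul (Real.exp_nonneg _), eexp, eexp]

@[simp] theorem eexp_zero : eexp 0 = 1 := by simp [eexp]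

theorem eexp_pow (x : ℝ) (k : ℕ) : eexp x ^ k = eexp (k * x) := by
  rw [eexp, ← ENNReal.ofReal_pow (Real.exp_nonneg _), ← Real.exp_nat_mul, eexp]

theorem eexp_mono {x y : ℝ} (h : x ≤ y) : eexp x ≤ eexp y :=
  ENNReal.ofReal_le_ofReal (Real.exp_le_exp.mpr h)

theorem one_le_eexp {x : ℝ} (h : 0 ≤ x) : 1 ≤ eexp x := eexp_zero ▸ eexp_mono h

theorem eexp_neg_le_of_log_le {x y : ℝ} (hy : 0 < y) (h : Real.log (1 / y) ≤ x) :
    eexp (-x) ≤ ENNReal.ofReal y := by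
  refine ENNReal.ofReal_le_ofReal ((Real.le_log_iff_exp_le hy).mp ?_)
  rw [one_div, Real.log_inv] at h
  linarith

/-- The expectation of a real-valued function on a finite type. -/
noncomputable def mean {ι : Type*} [Fintype ι] (p : PMF ι) (X : ι → ℝ) : ℝ :=
  ∑ i, (p i).toReal * X i

theorem expect_eexp_mul_le_of_mem_Icc {ι : Type*} [Fintype ι] (p : PMF ι) {X : ι → ℝ} {a b : ℝ}
    (hX : ∀ i, X i ∈ Set.Icc a b) (t : ℝ) :
    (expect p fun i => eexp (t * X i)) ≤ eexp (t * mean p X + t ^ 2 * (b - a) ^ 2 / 8) := by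
  let _ : MeasurableSpace ι := ⊤
  have : MeasurableSingletonClass ι := ⟨fun _ => trivial⟩
  have h_mgf := (ProbabilityTheory.hasSubgaussianMGF_of_mem_Icc (μ := p.toMeasure) (X := X)
    (measurable_from_top.aemeasurable) (Filter.Eventually.of_forall hX)).mgf_le t
  simp only [ProbabilityTheory.mgf, PMF.integral_eq_sum, smul_eq_mul] at h_mgf
  have h_expect : (expect p fun i => eexp (t * X i)) =
      eexp (t * mean p X) * ENNReal.ofReal
        (∑ i, (p i).toReal * Real.exp (t * (X i - mean p X))) := by
    rw [ENNReal.ofReal_sum_of_nonneg fun i _ => by positivity, expect_eq_sum, Finset.mul_sum]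
    refine Finset.sum_congr rfl fun i _ => ?_
    rw [ENNReal.ofReal_mul ENNReal.toReal_nonneg, ENNReal.ofReal_toReal (p.apply_ne_top i), ← eexp,
      mul_left_comm, ← eexp_add]
    ring_nf
  rw [h_expect, eexp_add]
  gcongr
  refine ENNReal.ofReal_le_ofReal (h_mgf.trans_eq ?_)
  congr 1
  simp only [NNReal.coe_pow, NNReal.coe_div, coe_nnnorm, NNReal.coe_ofNat, div_pow,
    Real.norm_eq_abs, sq_abs]
  ring

end Expectation

section Iteration

open scoped ENNReal

variable {α : Type} {body : ℕ → α → PMF α}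

theorem iterateM_support {I : ℕ → α → Prop} {K : ℕ} {a : α}
    (hI : ∀ k < K, ∀ a, I k a → ∀ b ∈ (body k a).support, I (k + 1) b) (ha : I 0 a) :
    ∀ b ∈ (iterateM body K a).support, I K b := by
  induction K with
  | zero => simpa [iterateM] using ha
  | succ K ih =>
    intro b hb
    obtain ⟨b', hb', hb⟩ := (PMF.mem_support_bind_iff _ _ _).mp hb
    exact hI K K.lt_succ_self b' (ih (fun k hk => hI k (hk.trans K.lt_succ_self)) b' hb') b hb

variable {I : α → Prop} {Φ : α → ℝ≥0∞} {r : ℝ≥0∞} {a : α}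

theorem expect_iterateM_le (hI : ∀ k a, I a → ∀ b ∈ (body k a).support, I b)
    (hΦ : ∀ k a, I a → expect (body k a) Φ ≤ r * Φ a) (ha : I a) (K : ℕ) :
    expect (iterateM body K a) Φ ≤ r ^ K * Φ a := by
  induction K with
  | zero => simp [iterateM]
  | succ K ih =>
    have h_inv := iterateM_support (I := fun _ => I) (fun k _ => hI k) ha (K := K)
    calc expect (iterateM body (K + 1) a) Φ
        = expect (iterateM body K a) fun b => expect (body K b) Φ := expect_bind _ _ _
      _ ≤ expect (iterateM body K a) fun b => r * Φ b :=
          expect_mono fun b hb => hΦ K b (h_inv b hb)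
      _ ≤ r ^ (K + 1) * Φ a := by
          rw [expect_const_mul, pow_succ', mul_assoc]
          gcongr

theorem toOuterMeasure_iterateM_le {s : Set α} {w : ℝ≥0∞}
    (hI : ∀ k a, I a → ∀ b ∈ (body k a).support, I b)
    (hΦ : ∀ k a, I a → expect (body k a) Φ ≤ r * Φ a)
    (hs : ∀ a ∈ s, I a → 1 ≤ w * Φ a) (ha : I a) (K : ℕ) :
    (iterateM body K a).toOuterMeasure s ≤ w * (r ^ K * Φ a) := by
  have h_inv := iterateM_support (I := fun _ => I) (fun k _ => hI k) ha (K := K)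
  calc (iterateM body K a).toOuterMeasure s
      ≤ expect (iterateM body K a) fun b => w * Φ b :=
        toOuterMeasure_le_expect fun b hb hbs => hs b hbs (h_inv b hb)
    _ ≤ w * (r ^ K * Φ a) := by
        rw [expect_const_mul]
        gcongr
        exact expect_iterateM_le hI hΦ ha K

end Iteration

/-! ## Program logic -/

section Expressions

namespace CExpr

variable {r : Var → ℝ} {m : ℕ → ℝ} {a b : CExpr}

@[simp] theorem eval_ofNat (k : ℕ) : eval r m ofNat(k) = (OfNat.ofNat k : ℕ) := rfl

@[simp] theorem eval_var (v : Var) : eval r m (var v) = r v := rfl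

@[simp] theorem eval_arr : eval r m (arr a) = m ⌊a.eval r m⌋₊ := rfl

@[simp] theorem eval_add : eval r m (a + b) = a.eval r m + b.eval r m := rfl

@[simp] theorem eval_sub : eval r m (a - b) = a.eval r m - b.eval r m := rfl

@[simp] theorem eval_mul : eval r m (a * b) = a.eval r m * b.eval r m := rfl

@[simp] theorem eval_div : eval r m (a / b) = a.eval r m / b.eval r m := rfl

@[simp] theorem eval_log : eval r m (log a) = Real.log (a.eval r m) := rfl

@[simp] theorem eval_ceil : eval r m (ceil a) = (⌈a.eval r m⌉ : ℝ) := rfl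

@[simp] theorem cost_ofNat (k : ℕ) : cost ofNat(k) = 1 := rfl

@[simp] theorem cost_var (v : Var) : (var v).cost = 1 := rfl

@[simp] theorem cost_arr : (arr a).cost = a.cost + 1 := rfl

@[simp] theorem cost_add : (a + b).cost = a.cost + b.cost + 1 := rfl

@[simp] theorem cost_sub : (a - b).cost = a.cost + b.cost + 1 := rfl

@[simp] theorem cost_mul : (a * b).cost = a.cost + b.cost + 1 := rfl

@[simp] theorem cost_div : (a / b).cost = a.cost + b.cost + 1 := rfl

@[simp] theorem cost_log : (log a).cost = a.cost + 1 := rfl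

@[simp] theorem cost_ceil : (ceil a).cost = a.cost + 1 := rfl

/-- The expression reads no array cell and no variable outside `V`. -/
def readsOnly (V : Finset Var) : CExpr → Bool
  | const _ => true
  | var v => v ∈ V
  | arr _ => false
  | add a b => a.readsOnly V && b.readsOnly V
  | sub a b => a.readsOnly V && b.readsOnly V
  | mul a b => a.readsOnly V && b.readsOnly V
  | div a b => a.readsOnly V && b.readsOnly V
  | log a => a.readsOnly V
  | ceil a => a.readsOnly V

theorem eval_congr {V : Finset Var} {r' : Var → ℝ} {m' : ℕ → ℝ} {e : CExpr}
    (he : e.readsOnly V) (hr : ∀ v ∈ V, r v = r' v) : e.eval r m = e.eval r' m' := by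
  induction e with
  | const k => rfl
  | var v => exact hr v (of_decide_eq_true he)
  | arr _ => cases he
  | add a b iha ihb | sub a b iha ihb | mul a b iha ihb | div a b iha ihb =>
    rw [readsOnly, Bool.and_eq_true] at he
    simp only [eval, iha he.1, ihb he.2]
  | log a ih | ceil a ih => simp only [eval, ih he]

end CExpr

end Expressions

section Frame

variable {n : ℕ} {f : (Fin n → Bool) → Bool} {c c' : Config n} {v : Var}

@[simp] theorem Config.reg_set (c : Config n) (v : Var) (x : ℝ) :
    (c.set v x).reg = Function.update c.reg v x := rfl

@[simp] theorem Config.mem_set (c : Config n) (v : Var) (x : ℝ) : (c.set v x).mem = c.mem := rfl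

@[simp] theorem Config.reg_tick (c : Config n) (k : ℕ) : (c.tick k).reg = c.reg := rfl

@[simp] theorem Config.mem_tick (c : Config n) (k : ℕ) : (c.tick k).mem = c.mem := rfl

@[simp] theorem Config.psi_tick (c : Config n) (k : ℕ) : (c.tick k).psi = c.psi := rfl

/-- The configuration after qubit `q` has been measured with outcome `b`. -/
noncomputable def Config.collapse (c : Config n) (q : Fin (n + 1)) (v : Var) (b : Bool) :
    Config n :=
  { c.set v (if b then 1 else 0) with psi := project q b c.psi }

theorem Config.measure_of_lt (c : Config n) {q : ℕ} (hq : q < n + 1) (v : Var) :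
    c.measure q v = (bornPMF ⟨q, hq⟩ c.psi).map (c.collapse ⟨q, hq⟩ v) := by
  rw [measure, dif_pos hq]
  rfl

theorem Config.eq_or_eq_collapse_of_mem_support_measure {q : ℕ}
    (h : c' ∈ (c.measure q v).support) : c' = c ∨ ∃ q b, c' = c.collapse q v b := by
  by_cases hq : q < n + 1
  · rw [c.measure_of_lt hq, PMF.mem_support_map_iff] at h
    obtain ⟨b, -, rfl⟩ := h
    exact Or.inr ⟨_, b, rfl⟩
  · rw [measure, dif_neg hq, PMF.mem_support_pure_iff] at h
    exact Or.inl h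

/-- The scalar variables to which a program may write. -/
def Prog.written : Prog → Finset Var
  | .assign v _ => {v}
  | .seq p q => p.written ∪ q.written
  | .ifLE _ _ p q => p.written ∪ q.written
  | .loop v _ p => insert v p.written
  | .meas _ v => {v}
  | _ => ∅

theorem Prog.reg_eq_of_notMem_written {p : Prog} (hp : v ∉ p.written)
    (h : c' ∈ (p.exec f c).support) : c'.reg v = c.reg v := by
  induction p generalizing c c' with
  | skip | store | fresh | had | tgate | cnot | answer =>
    simp only [exec, PMF.mem_support_pure_iff] at h
    subst h
    rfl
  | assign w e =>
    simp only [exec, PMF.mem_support_pure_iff] at h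
    subst h
    simp_all [written]
  | seq p q ihp ihq =>
    rw [written, Finset.notMem_union] at hp
    obtain ⟨c₁, h₁, h₂⟩ := (PMF.mem_support_bind_iff _ _ _).mp h
    rw [ihq hp.2 h₂, ihp hp.1 h₁]
  | ifLE a b p q ihp ihq =>
    rw [written, Finset.notMem_union] at hp
    rw [exec] at h
    split_ifs at h
    · exact (ihp hp.1 h).trans rfl
    · exact (ihq hp.2 h).trans rfl
  | loop w e p ih =>
    rw [written, Finset.mem_insert, not_or] at hp
    refine iterateM_support (I := fun _ c' => c'.reg v = c.reg v) (fun k _ c₁ h₁ c₂ h₂ => ?_)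
      rfl c' h
    rw [ih hp.2 h₂, ← h₁]
    simp [hp.1]
  | meas q w =>
    rcases Config.eq_or_eq_collapse_of_mem_support_measure h with rfl | ⟨q, b, rfl⟩
    · rfl
    · simp_all [written, Config.collapse]

/-- The variables in `V` have the values prescribed by `r`. -/
def Config.Agrees (V : Finset Var) (r : Var → ℝ) (c : Config n) : Prop := ∀ v ∈ V, c.reg v = r v

theorem Config.Agrees.exec {V : Finset Var} {r : Var → ℝ} {p : Prog} (hc : c.Agrees V r)
    (hp : Disjoint p.written V) (h : c' ∈ (p.exec f c).support) : c'.Agrees V r := fun v hv => by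
  rw [Prog.reg_eq_of_notMem_written (Finset.disjoint_right.mp hp hv) h, hc v hv]

theorem Config.Agrees.set_tick {V : Finset Var} {r : Var → ℝ} (hc : c.Agrees V r) (hv : v ∉ V)
    (x : ℝ) (k : ℕ) : ((c.set v x).tick k).Agrees V r := fun w hw => by
  simpa [ne_of_mem_of_not_mem hw hv] using hc w hw

end Frame

section Costs

variable {n : ℕ} {f : (Fin n → Bool) → Bool}

/-- No copy of the function state is loaded. -/
def Prog.isCopyFree : Prog → Bool
  | .fresh => false
  | .seq p q => p.isCopyFree && q.isCopyFree
  | .ifLE _ _ p q => p.isCopyFree && q.isCopyFree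
  | .loop _ _ p => p.isCopyFree
  | _ => true

/-- Loop bounds only read variables in `V`, and the branches of conditionals load no copies; if the
program does not write to `V` either, then the number of passes through every loop and the number of
copies can be computed from the values of these variables. -/
def Prog.isStatic (V : Finset Var) : Prog → Bool
  | .seq p q => p.isStatic V && q.isStatic V
  | .ifLE _ _ p q => p.isStatic V && q.isStatic V && p.isCopyFree && q.isCopyFree
  | .loop _ e p => e.readsOnly V && p.isStatic V
  | _ => true

/-- The number of copies loaded by a static program whose loop bounds are evaluated at `r`. -/
noncomputable def Prog.numCopies (r : Var → ℝ) : Prog → ℕ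
  | .fresh => 1
  | .seq p q => p.numCopies r + q.numCopies r
  | .loop _ e p => ⌊e.eval r 0⌋₊ * p.numCopies r
  | _ => 0

/-- A bound for the number of elementary operations performed by a static program whose loop bounds
are evaluated at `r`. -/
noncomputable def Prog.stepBound (n : ℕ) (r : Var → ℝ) : Prog → ℕ
  | .skip => 1
  | .assign _ e => 1 + e.cost
  | .store a e => 1 + a.cost + e.cost
  | .seq p q => p.stepBound n r + q.stepBound n r
  | .ifLE a b p q => 1 + a.cost + b.cost + max (p.stepBound n r) (q.stepBound n r)
  | .loop _ e p => 1 + e.cost + ⌊e.eval r 0⌋₊ * (1 + p.stepBound n r)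
  | .fresh => n + 2
  | .had q => 1 + q.cost
  | .tgate q => 1 + q.cost
  | .cnot q t => 1 + q.cost + t.cost
  | .meas q _ => 1 + q.cost
  | .answer _ => 1

theorem Prog.numCopies_of_isCopyFree (r : Var → ℝ) {p : Prog} (hp : p.isCopyFree) :
    p.numCopies r = 0 := by
  induction p with
  | fresh => cases hp
  | seq p q ihp ihq =>
    rw [isCopyFree, Bool.and_eq_true] at hp
    rw [numCopies, ihp hp.1, ihq hp.2]
  | loop v e p ih => rw [numCopies, ih hp, mul_zero]
  | _ => rfl

theorem iterateM_cost {body : ℕ → Config n → PMF (Config n)} {I : Config n → Prop} {T K m : ℕ}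
    {c : Config n} (hI : ∀ k c, I c → ∀ c' ∈ (body k c).support, I c')
    (hbody : ∀ k c, I c → ∀ c' ∈ (body k c).support,
      c'.steps ≤ c.steps + T ∧ c'.copies = c.copies + K) (hc : I c) :
    ∀ c' ∈ (iterateM body m c).support,
      c'.steps ≤ c.steps + m * T ∧ c'.copies = c.copies + m * K := by
  intro c' hc'
  refine (iterateM_support (I := fun k c' => I c' ∧ c'.steps ≤ c.steps + k * T ∧
    c'.copies = c.copies + k * K) (fun k _ c₁ h₁ c₂ h₂ => ?_) (by simpa using hc) c' hc').2
  obtain ⟨h_steps, h_copies⟩ := hbody k c₁ h₁.1 c₂ h₂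
  refine ⟨hI k c₁ h₁.1 c₂ h₂, ?_, ?_⟩ <;> linarith [h₁.2.1, h₁.2.2]

theorem Prog.exec_cost {V : Finset Var} {r : Var → ℝ} {p : Prog} (hp : p.isStatic V)
    (hV : Disjoint p.written V) {c c' : Config n} (hc : c.Agrees V r)
    (h : c' ∈ (p.exec f c).support) :
    c'.steps ≤ c.steps + p.stepBound n r ∧ c'.copies = c.copies + p.numCopies r := by
  induction p generalizing c c' with
  | skip | store | fresh | had | tgate | cnot | answer | assign =>
    simp only [exec, PMF.mem_support_pure_iff] at h
    subst h
    exact ⟨by simp [Config.tick, Config.set, stepBound, add_assoc, add_left_comm], rfl⟩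
  | seq p q ihp ihq =>
    rw [isStatic, Bool.and_eq_true] at hp
    rw [written, Finset.disjoint_union_left] at hV
    obtain ⟨c₁, h₁, h₂⟩ := (PMF.mem_support_bind_iff _ _ _).mp h
    have hp_cost := ihp hp.1 hV.1 hc h₁
    have hq_cost := ihq hp.2 hV.2 (hc.exec hV.1 h₁) h₂
    simp only [stepBound, numCopies]
    omega
  | ifLE a b p q ihp ihq =>
    simp only [isStatic, Bool.and_eq_true] at hp
    rw [written, Finset.disjoint_union_left] at hV
    have hp_copies := numCopies_of_isCopyFree r hp.1.2
    have hq_copies := numCopies_of_isCopyFree r hp.2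
    rw [exec] at h
    simp only [stepBound, numCopies]
    split_ifs at h
    · have h_cost := ihp hp.1.1.1 hV.1 (c := c.tick _) hc h
      simp only [Config.tick] at h_cost
      omega
    · have h_cost := ihq hp.1.1.2 hV.2 (c := c.tick _) hc h
      simp only [Config.tick] at h_cost
      omega
  | loop v e p ih =>
    rw [isStatic, Bool.and_eq_true] at hp
    rw [written, Finset.disjoint_insert_left] at hV
    rw [exec, Config.idx, Config.val, CExpr.eval_congr hp.1 hc (m' := 0)] at h
    have h_cost := iterateM_cost (I := Config.Agrees V r) (T := 1 + p.stepBound n r)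
      (K := p.numCopies r)
      (fun k c₁ h₁ c₂ h₂ => (h₁.set_tick hV.1 _ _).exec hV.2 h₂)
      (fun k c₁ h₁ c₂ h₂ => ?_) (c := c.tick (1 + e.cost)) hc c' h
    · simpa only [stepBound, numCopies, Config.tick, add_assoc] using h_cost
    · simpa only [Config.tick, Config.set, add_assoc] using
        ih hp.2 hV.2 (h₁.set_tick hV.1 k 1) h₂
  | meas q v =>
    rcases Config.eq_or_eq_collapse_of_mem_support_measure h with rfl | ⟨q, b, rfl⟩ <;>
    simp [Config.tick, stepBound, numCopies, Config.collapse, Config.set]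

end Costs

section Triples

open scoped ENNReal

variable {n : ℕ} {f : (Fin n → Bool) → Bool} {p q : Prog} {P Q R : Config n → Prop} {r s : ℝ≥0∞}

/-- A probabilistic Hoare triple: run from a configuration satisfying `P`, the program violates the
postcondition `Q` with probability at most `r`. -/
def Triple (f : (Fin n → Bool) → Bool) (P : Config n → Prop) (p : Prog) (Q : Config n → Prop)
    (r : ℝ≥0∞) : Prop :=
  ∀ c, P c → (p.exec f c).toOuterMeasure {c' | ¬ Q c'} ≤ r

theorem triple_zero_iff :
    Triple f P p Q 0 ↔ ∀ c, P c → ∀ c' ∈ (p.exec f c).support, Q c' := by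
  simp [Triple, toOuterMeasure_eq_zero_iff]

theorem Triple.seq (hp : Triple f P p Q r) (hq : Triple f Q q R s) :
    Triple f P (p;; q) R (r + s) := fun c hc =>
  toOuterMeasure_bind_le (hp c hc) fun c' hc' => hq c' (not_not.mp hc')

theorem Triple.mono {P' Q' : Config n → Prop} (h : Triple f P p Q r) (hP : ∀ c, P' c → P c)
    (hQ : ∀ c, Q c → Q' c) (hr : r ≤ s) : Triple f P' p Q' s := fun c hc => by
  have h_subset : {c' | ¬ Q' c'} ⊆ {c' | ¬ Q c'} := fun c' hc' hQc' => hc' (hQ c' hQc')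
  exact (MeasureTheory.measure_mono h_subset).trans ((h c (hP c hc)).trans hr)

theorem Triple.and (hQ : Triple f P p Q r) (hR : Triple f P p R s) :
    Triple f P p (fun c => Q c ∧ R c) (r + s) := fun c hc => by
  have h_union : {c' | ¬ (Q c' ∧ R c')} = {c' | ¬ Q c'} ∪ {c' | ¬ R c'} := by
    ext c'
    exact not_and_or
  rw [h_union]
  exact (MeasureTheory.measure_union_le _ _).trans (add_le_add (hQ c hc) (hR c hc))

theorem Triple.forall {ι : Type*} [Fintype ι] {Q : ι → Config n → Prop}
    (h : ∀ i, Triple f P p (Q i) r) :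
    Triple f P p (fun c => ∀ i, Q i c) (Fintype.card ι * r) := fun c hc => by
  have h_union : {c' | ¬ ∀ i, Q i c'} = ⋃ i, {c' | ¬ Q i c'} := by
    ext c'
    simp
  calc (p.exec f c).toOuterMeasure {c' | ¬ ∀ i, Q i c'}
      ≤ ∑ i, (p.exec f c).toOuterMeasure {c' | ¬ Q i c'} := by
        rw [h_union]
        exact MeasureTheory.measure_iUnion_fintype_le _ _
    _ ≤ ∑ _i : ι, r := Finset.sum_le_sum fun i _ => h i c hc
    _ = Fintype.card ι * r := by simp

theorem triple_loop {v : Var} {e : CExpr} {I : ℕ → Config n → Prop} {K : ℕ}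
    (hK : ∀ c, P c → c.idx e = K) (h_init : ∀ c, P c → I 0 (c.tick (1 + e.cost)))
    (h_step : ∀ k < K, Triple f (fun c => ∃ c₀, I k c₀ ∧ c = (c₀.set v k).tick 1) p (I (k + 1)) 0) :
    Triple f P (.loop v e p) (I K) 0 := by
  rw [triple_zero_iff]
  intro c hc c' hc'
  rw [Prog.exec, hK c hc] at hc'
  exact iterateM_support
    (fun k hk c₁ h₁ => triple_zero_iff.mp (h_step k hk) _ ⟨c₁, h₁, rfl⟩) (h_init c hc) c' hc'

end Triples

/-! ## Sequential measurements -/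

section Measurement

open scoped ENNReal

variable {n : ℕ}

theorem sqNorm_project_add (q : Fin (n + 1)) (ψ : Amp n) :
    sqNorm (project q true ψ) + sqNorm (project q false ψ) = sqNorm ψ := by
  simp_rw [sqNorm, project, ← Finset.sum_add_distrib]
  refine Finset.sum_congr rfl fun z _ => ?_
  cases z q <;> simp

theorem sqNorm_mul_bornProb (q : Fin (n + 1)) (ψ : Amp n) :
    sqNorm ψ * bornProb q ψ = sqNorm (project q true ψ) := by
  rcases eq_or_ne (sqNorm ψ) 0 with h | h
  · have h_add := sqNorm_project_add q ψ
    rw [h, add_eq_zero] at h_add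
    rw [h, zero_mul, h_add.1]
  · exact mul_div_cancel₀ _ h

/- Multiplying by the squared norm clears the denominators in Born's rule, so that successive
measurements compose without normalising the states in between. -/
theorem sqNorm_mul_expect_bornPMF (q : Fin (n + 1)) (ψ : Amp n) (φ : Bool → ℝ≥0∞) :
    (sqNorm ψ : ℝ≥0∞) * expect (bornPMF q ψ) φ =
      ∑ b, (sqNorm (project q b ψ) : ℝ≥0∞) * φ b := by
  have h_false : sqNorm ψ * (1 - bornProb q ψ) = sqNorm (project q false ψ) := by
    rw [mul_tsub, mul_one, sqNorm_mul_bornProb, ← sqNorm_project_add q ψ, add_tsub_cancel_left]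
  rw [expect_eq_sum, Fintype.sum_bool, Fintype.sum_bool, mul_add, ← mul_assoc, ← mul_assoc,
    ← sqNorm_mul_bornProb, ← h_false]
  simp [bornPMF]

/-- The result of the deterministic steps `step 0 (w 0)`, `step 1 (w 1)`, …, `step (K - 1)`. -/
def runSteps (step : ℕ → Bool → Config n → Config n) :
    (K : ℕ) → (Fin K → Bool) → Config n → Config n
  | 0, _, c => c
  | K + 1, w, c => step K (w (Fin.last K)) (runSteps step K (Fin.init w) c)

theorem sum_snoc {M : Type*} [AddCommMonoid M] {K : ℕ} (F : (Fin (K + 1) → Bool) → M) :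
    ∑ w, F w = ∑ b, ∑ w : Fin K → Bool, F (Fin.snoc w b) := by
  rw [← (Fin.snocEquiv fun _ : Fin (K + 1) => Bool).sum_comp F, Fintype.sum_prod_type]
  rfl

section RunSteps

variable {body : ℕ → Config n → PMF (Config n)} {step : ℕ → Bool → Config n → Config n}

theorem sqNorm_mul_expect_iterateM
    (h_body : ∀ k (hk : k < n + 1) c, body k c = (bornPMF ⟨k, hk⟩ c.psi).map (step k · c))
    (h_psi : ∀ k (hk : k < n + 1) b c, (step k b c).psi = project ⟨k, hk⟩ b c.psi)
    {K : ℕ} (hK : K ≤ n) (c : Config n) (φ : Config n → ℝ≥0∞) :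
    (sqNorm c.psi : ℝ≥0∞) * expect (iterateM body K c) φ =
      ∑ w, (sqNorm (runSteps step K w c).psi : ℝ≥0∞) * φ (runSteps step K w c) := by
  induction K generalizing φ with
  | zero => simp [iterateM, runSteps]
  | succ K ih =>
    rw [iterateM, expect_bind, ih (by omega), sum_snoc, Finset.sum_comm]
    refine Finset.sum_congr rfl fun w _ => ?_
    rw [h_body K (by omega), expect_map, sqNorm_mul_expect_bornPMF]
    simp only [runSteps, Fin.snoc_last, Fin.init_snoc, h_psi K (by omega)]

theorem runSteps_psi
    (h_psi : ∀ k (hk : k < n + 1) b c, (step k b c).psi = project ⟨k, hk⟩ b c.psi)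
    {K : ℕ} (hK : K ≤ n) (w : Fin K → Bool) (c : Config n) (z : Fin (n + 1) → Bool) :
    (runSteps step K w c).psi z =
      if ∀ j : Fin K, z (Fin.castLE hK j).castSucc = w j then c.psi z else 0 := by
  induction K with
  | zero => simp [runSteps]
  | succ K ih =>
    rw [runSteps, h_psi K (by omega), project, ih (by omega), ← ite_and]
    refine if_congr ?_ rfl rfl
    rw [Fin.forall_fin_succ', and_comm]
    rfl

theorem project_last_snoc (ψ : Amp n) (b b' : Bool) (x : Fin n → Bool) :
    project (Fin.last n) b ψ (Fin.snoc x b') = if b' = b then ψ (Fin.snoc x b) else 0 := by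
  rw [project, Fin.snoc_last]
  split_ifs with h
  · rw [h]
  · rfl

theorem sqNorm_project_last (ψ : Amp n) (b : Bool) :
    sqNorm (project (Fin.last n) b ψ) = ∑ x : Fin n → Bool, ‖ψ (Fin.snoc x b)‖₊ ^ 2 := by
  rw [sqNorm, sum_snoc, Finset.sum_eq_single b (fun b' _ hb => ?_) (by simp)]
  · simp only [project_last_snoc, if_true]
  · simp [project_last_snoc, hb]

theorem sqNorm_runSteps
    (h_psi : ∀ k (hk : k < n + 1) b c, (step k b c).psi = project ⟨k, hk⟩ b c.psi)
    (w : Fin n → Bool) {c : Config n} {b : Bool} {ψ : Amp n}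
    (hc : c.psi = project (Fin.last n) b ψ) :
    sqNorm (runSteps step n w c).psi = ‖ψ (Fin.snoc w b)‖₊ ^ 2 := by
  have h_amp : ∀ b' x, (runSteps step n w c).psi (Fin.snoc x b') =
      if b' = b ∧ x = w then ψ (Fin.snoc w b) else 0 := by
    intro b' x
    simp only [runSteps_psi h_psi le_rfl, Fin.castLE_rfl, id_eq, Fin.snoc_castSucc, ← funext_iff,
      hc, project_last_snoc, ← ite_and]
    split_ifs <;> simp_all
  have h_sq : ∀ b' x, ‖(runSteps step n w c).psi (Fin.snoc x b')‖₊ ^ 2 =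
      if b' = b then if x = w then ‖ψ (Fin.snoc w b)‖₊ ^ 2 else 0 else 0 := by
    intro b' x
    rw [h_amp, ← ite_and]
    split_ifs <;> simp
  simp [sqNorm, sum_snoc, h_sq, Finset.sum_ite_irrel]

end RunSteps

end Measurement

/-! ## Hadamard gates on the function state -/

section Hadamard

variable {n : ℕ}

/-- The sign `(-1)^{ab}` of the entry of the Hadamard matrix in row `a` and column `b`. -/
def hadamardSign (a b : Bool) : ℝ := if a then bitSign b else 1

theorem hadamardSign_sq (a b : Bool) : hadamardSign a b ^ 2 = 1 := by
  cases a <;> cases b <;> simp [hadamardSign]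

/-- Up to the factor `√2` of each Hadamard gate, the entry for qubit `j` in the matrix of Hadamard
gates on the qubits `0, …, k - 1`. -/
def hadamardEntry (k j : ℕ) (a b : Bool) : ℝ :=
  if j < k then hadamardSign a b else if a = b then 1 else 0

/-- The state obtained from `ψ` by Hadamard gates on the qubits `0, …, k - 1`. -/
noncomputable def hadamardState (k : ℕ) (ψ : Amp n) : Amp n := fun z =>
  (∑ y, ψ y * ((∏ j : Fin (n + 1), hadamardEntry k j (z j) (y j) : ℝ) : ℂ)) / ((√2 : ℝ) : ℂ) ^ k

theorem hadamardState_zero (ψ : Amp n) : hadamardState 0 ψ = ψ := by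
  funext z
  simp [hadamardState, hadamardEntry, Finset.prod_ite_zero, ← funext_iff, apply_ite Complex.ofReal]

theorem prod_hadamardEntry_update {k : ℕ} (hk : k < n + 1) (b : Bool)
    (z y : Fin (n + 1) → Bool) :
    ∏ j : Fin (n + 1), hadamardEntry k j (Function.update z ⟨k, hk⟩ b j) (y j) =
      (if b = y ⟨k, hk⟩ then 1 else 0) *
        ∏ j ∈ Finset.univ.erase (⟨k, hk⟩ : Fin (n + 1)), hadamardEntry k j (z j) (y j) := by
  rw [← Finset.mul_prod_erase _ _ (Finset.mem_univ (⟨k, hk⟩ : Fin (n + 1)))]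
  congr 1
  · simp [hadamardEntry]
  · refine Finset.prod_congr rfl fun j hj => ?_
    rw [Function.update_of_ne (Finset.ne_of_mem_erase hj)]

theorem prod_hadamardEntry_succ {k : ℕ} (hk : k < n + 1) (z y : Fin (n + 1) → Bool) :
    ∏ j : Fin (n + 1), hadamardEntry (k + 1) j (z j) (y j) =
      hadamardSign (z ⟨k, hk⟩) (y ⟨k, hk⟩) *
        ∏ j ∈ Finset.univ.erase (⟨k, hk⟩ : Fin (n + 1)), hadamardEntry k j (z j) (y j) := by
  rw [← Finset.mul_prod_erase _ _ (Finset.mem_univ (⟨k, hk⟩ : Fin (n + 1)))]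
  congr 1
  · simp [hadamardEntry]
  · refine Finset.prod_congr rfl fun j hj => ?_
    have h_ne : (j : ℕ) ≠ k := fun h => Finset.ne_of_mem_erase hj (Fin.ext h)
    rw [hadamardEntry, hadamardEntry, if_congr (Nat.lt_succ_iff_lt_or_eq.trans (or_iff_left h_ne))
      rfl rfl]

theorem gateH_hadamardState {k : ℕ} (hk : k < n + 1) (ψ : Amp n) :
    gateH k (hadamardState k ψ) = hadamardState (k + 1) ψ := by
  funext z
  rw [gateH, dif_pos hk]
  simp only [hadamardState, prod_hadamardEntry_update hk, prod_hadamardEntry_succ hk]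
  rw [mul_div_assoc', ← add_div, div_div, pow_succ, Finset.mul_sum, ← Finset.sum_add_distrib]
  congr 1
  refine Finset.sum_congr rfl fun y _ => ?_
  cases z ⟨k, hk⟩ <;> cases y ⟨k, hk⟩ <;> simp [hadamardSign]

/-- The set with indicator string `w`. -/
def bitSet (w : Fin n → Bool) : Finset (Fin n) := Finset.univ.filter fun i => w i = true

theorem sum_bitSet {M : Type*} [AddCommMonoid M] (F : Finset (Fin n) → M) :
    ∑ w, F (bitSet w) = ∑ S, F S := by
  let e : (Fin n → Bool) ≃ Finset (Fin n) :=
    { toFun := bitSet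
      invFun := fun S i => decide (i ∈ S)
      left_inv := fun w => by simp [bitSet]
      right_inv := fun S => by simp [bitSet] }
  exact e.sum_comp F

theorem walsh_bitSet (w x : Fin n → Bool) :
    walsh (bitSet w) x = ∏ i, hadamardSign (w i) (x i) := by
  rw [walsh, bitSet, Finset.prod_filter]
  rfl

theorem prod_hadamardEntry_snoc (w x : Fin n → Bool) (a b : Bool) :
    ∏ j : Fin (n + 1), hadamardEntry (n + 1) j (Fin.snoc (α := fun _ => Bool) w a j)
        (Fin.snoc (α := fun _ => Bool) x b j) =
      walsh (bitSet w) x * hadamardSign a b := by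
  simp [Fin.prod_univ_castSucc, walsh_bitSet, hadamardEntry]

theorem functionState_snoc (f : (Fin n → Bool) → Bool) (x : Fin n → Bool) (b : Bool) :
    functionState f (Fin.snoc x b) = if b = f x then ((1 / √(2 ^ n) : ℝ) : ℂ) else 0 := by
  simp only [functionState, Fin.snoc_last, Fin.snoc_castSucc]

theorem hadamardState_functionState_snoc (f : (Fin n → Bool) → Bool) (w : Fin n → Bool) (a : Bool) :
    hadamardState (n + 1) (functionState f) (Fin.snoc w a) =
      ((cubeFourier (fun x => hadamardSign a (f x)) (bitSet w) / √2 : ℝ) : ℂ) := by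
  have h_sqrt : √(2 ^ n : ℝ) * √2 ^ (n + 1) = 2 ^ n * √2 := by
    have h_pow : √2 ^ n = √(2 ^ n : ℝ) := by
      rw [← Real.sqrt_sq (by positivity : 0 ≤ √2 ^ n), pow_right_comm, Real.sq_sqrt zero_le_two]
    rw [pow_succ, ← mul_assoc, h_pow, Real.mul_self_sqrt (by positivity)]
  calc hadamardState (n + 1) (functionState f) (Fin.snoc w a)
      = (∑ x, ((1 / √(2 ^ n) : ℝ) : ℂ) * ((walsh (bitSet w) x * hadamardSign a (f x) : ℝ) : ℂ)) /
          ((√2 : ℝ) : ℂ) ^ (n + 1) := by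
        rw [hadamardState, sum_snoc, Finset.sum_comm]
        simp_rw [prod_hadamardEntry_snoc, functionState_snoc, ite_mul, zero_mul,
          Finset.sum_ite_eq', Finset.mem_univ, if_true]
    _ = ((cubeFourier (fun x => hadamardSign a (f x)) (bitSet w) / √2 : ℝ) : ℂ) := by
        norm_cast
        rw [← Finset.mul_sum, cubeFourier_eq, div_div, ← h_sqrt, one_div_mul_eq_div, div_div]
        push_cast
        simp_rw [mul_comm]

theorem coe_nnnorm_ofReal_sq (r : ℝ) :
    ((‖(r : ℂ)‖₊ ^ 2 : ℝ≥0) : ENNReal) = ENNReal.ofReal (r ^ 2) := by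
  rw [ENNReal.ofReal]
  congr 1
  rw [← NNReal.coe_inj, Real.coe_toNNReal _ (sq_nonneg r)]
  simp

theorem sqNorm_project_last_hadamardState (f : (Fin n → Bool) → Bool) (a : Bool) :
    (sqNorm (project (Fin.last n) a (hadamardState (n + 1) (functionState f))) : ENNReal) =
      ENNReal.ofReal (1 / 2) := by
  rw [sqNorm_project_last, ENNReal.ofNNReal_finsetSum]
  simp_rw [hadamardState_functionState_snoc, coe_nnnorm_ofReal_sq, div_pow,
    Real.sq_sqrt zero_le_two]
  rw [sum_bitSet fun S => ENNReal.ofReal (cubeFourier (fun x => hadamardSign a (f x)) S ^ 2 / 2),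
    ← ENNReal.ofReal_sum_of_nonneg fun S _ => by positivity, ← Finset.sum_div, parseval]
  simp [hadamardSign_sq, cubeExp]

theorem sqNorm_hadamardState (f : (Fin n → Bool) → Bool) :
    (sqNorm (hadamardState (n + 1) (functionState f)) : ENNReal) = 1 := by
  rw [← sqNorm_project_add (Fin.last n), ENNReal.coe_add, sqNorm_project_last_hadamardState,
    sqNorm_project_last_hadamardState, ← ENNReal.ofReal_add (by norm_num) (by norm_num)]
  norm_num

theorem nnnorm_functionState_snoc_sq (f : (Fin n → Bool) → Bool) (x : Fin n → Bool) (b : Bool) :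
    ((‖functionState f (Fin.snoc x b)‖₊ ^ 2 : ℝ≥0) : ENNReal) =
      if b = f x then ENNReal.ofReal (1 / 2 ^ n) else 0 := by
  rw [functionState_snoc]
  split_ifs
  · rw [coe_nnnorm_ofReal_sq, div_pow, Real.sq_sqrt (by positivity), one_pow]
  · simp

theorem sqNorm_functionState (f : (Fin n → Bool) → Bool) :
    (sqNorm (functionState f) : ENNReal) = 1 := by
  rw [sqNorm, sum_snoc, Finset.sum_comm]
  simp only [ENNReal.ofNNReal_finsetSum, nnnorm_functionState_snoc_sq, Finset.sum_ite_eq',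
    Finset.mem_univ, if_true]
  rw [← ENNReal.ofReal_sum_of_nonneg fun x _ => by positivity]
  simp

end Hadamard

/-! ## The law of a Fourier sampling attempt -/

section Execution

open scoped ENNReal

variable {n : ℕ} {f : (Fin n → Bool) → Bool} {c : Config n}

theorem expect_exec_seq (p q : Prog) (c : Config n) (φ : Config n → ℝ≥0∞) :
    expect ((p;; q).exec f c) φ = expect (p.exec f c) fun c' => expect (q.exec f c') φ := by
  rw [Prog.exec, expect_bind]

theorem Config.idx_var_of_eq {v : Var} {k : ℕ} (h : c.reg v = k) : c.idx v = k := by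
  rw [idx, val, CExpr.eval_var, h, Nat.floor_natCast]

/-- The configuration after a copy of the function state of `f` has been loaded. -/
noncomputable def Config.load (f : (Fin n → Bool) → Bool) (c : Config n) : Config n :=
  { c.tick (1 + (n + 1)) with psi := functionState f, copies := c.copies + 1 }

theorem expect_exec_fresh (c : Config n) (φ : Config n → ℝ≥0∞) :
    expect (Prog.fresh.exec f c) φ = φ (c.load f) := by
  rw [Prog.exec, expect_pure, Config.load]

theorem sqNorm_mul_expect_measure {q : ℕ} (hq : q < n + 1) (v : Var) (φ : Config n → ℝ≥0∞) :
    (sqNorm c.psi : ℝ≥0∞) * expect (c.measure q v) φ =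
      ∑ b, (sqNorm (project ⟨q, hq⟩ b c.psi) : ℝ≥0∞) * φ (c.collapse ⟨q, hq⟩ v b) := by
  rw [c.measure_of_lt hq, expect_map, sqNorm_mul_expect_bornPMF]

theorem runSteps_reg {step : ℕ → Bool → Config n → Config n} {v : Var}
    (h : ∀ k b c, (step k b c).reg v = c.reg v) (K : ℕ) (w : Fin K → Bool) (c : Config n) :
    (runSteps step K w c).reg v = c.reg v := by
  induction K with
  | zero => rfl
  | succ K ih => rw [runSteps, h, ih]

end Execution

section FourierAttempt

open scoped ENNReal

variable {n : ℕ} {f : (Fin n → Bool) → Bool} {c c' : Config n}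

open Prog in
/-- The part of `fourierAttempt` that applies a Hadamard gate to every qubit. -/
def hadamardAll : Prog := loop .i (Var.n + 1) (had Var.i)

open Prog in
/-- The part of `fourierAttempt` that measures the first `n` qubits and adds the outcomes to
`weight`. -/
def measureWeight : Prog :=
  loop .i Var.n (meas Var.i .bit;; assign .weight (Var.weight + Var.bit))

open Prog in
/-- The part of `fourierAttempt` that records `weight` if fewer than `m2` sets were found. -/
def recordWeight : Prog :=
  ifLE (Var.found + 1) Var.m2
    (assign .total (Var.total + Var.weight);; assign .found (Var.found + 1))
    skip

open Prog in
/-- The part of `fourierAttempt` that follows the Hadamard gates. -/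
def measureSet : Prog :=
  meas Var.n .label;;
  ifLE 1 Var.label (assign .weight 0;; measureWeight;; recordWeight) skip

theorem fourierAttempt_eq : fourierAttempt = (Prog.fresh;; hadamardAll;; measureSet) := rfl

theorem psi_of_mem_support_hadamardAll (hn : c.reg .n = n)
    (h : c' ∈ (hadamardAll.exec f c).support) : c'.psi = hadamardState (n + 1) c.psi := by
  have h_idx : c.idx (Var.n + 1) = n + 1 := by
    rw [Config.idx, Config.val, CExpr.eval_add, CExpr.eval_var, CExpr.eval_ofNat, hn]
    exact_mod_cast Nat.floor_natCast (n + 1)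
  rw [hadamardAll, Prog.exec, h_idx] at h
  refine iterateM_support (I := fun k c' => c'.psi = hadamardState k c.psi) ?_
    (hadamardState_zero _).symm c' h
  intro k hk c₁ h_psi c₂ h₂
  rw [Prog.exec, PMF.mem_support_pure_iff] at h₂
  subst h₂
  rw [Config.idx_var_of_eq (k := k) (by simp), ← gateH_hadamardState hk, ← h_psi]
  rfl

/-- One pass through the loop of `measureWeight`, with measurement outcome `b`. -/
noncomputable def weightStep (k : ℕ) (b : Bool) (c : Config n) : Config n :=
  let c' := ((c.set .i k).tick 3).collapse (Fin.ofNat (n + 1) k) .bit b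
  (c'.set .weight (c'.reg .weight + c'.reg .bit)).tick 4

theorem ofNat_eq_mk {k : ℕ} (hk : k < n + 1) : Fin.ofNat (n + 1) k = ⟨k, hk⟩ :=
  Fin.ext (Nat.mod_eq_of_lt hk)

theorem exec_measureWeight_body {k : ℕ} (hk : k < n + 1) (c : Config n) :
    (Prog.meas Var.i .bit;; .assign .weight (Var.weight + Var.bit)).exec f ((c.set .i k).tick 1) =
      (bornPMF ⟨k, hk⟩ c.psi).map (weightStep k · c) := by
  rw [Prog.exec, Prog.exec, Config.idx_var_of_eq (k := k) (by simp), Config.measure_of_lt _ hk,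
    PMF.bind_map]
  simp only [weightStep, ofNat_eq_mk hk]
  rfl

theorem weightStep_psi {k : ℕ} (hk : k < n + 1) (b : Bool) (c : Config n) :
    (weightStep k b c).psi = project ⟨k, hk⟩ b c.psi := by
  rw [← ofNat_eq_mk hk]
  rfl

theorem weightStep_weight (k : ℕ) (b : Bool) (c : Config n) :
    (weightStep k b c).reg .weight = c.reg .weight + if b then 1 else 0 := by
  simp [weightStep, Config.collapse]

theorem runSteps_weightStep_weight {K : ℕ} (w : Fin K → Bool) (c : Config n) :
    (runSteps weightStep K w c).reg .weight = c.reg .weight + (bitSet w).card := by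
  have h_card : ((bitSet w).card : ℝ) = ∑ j, if w j then 1 else 0 := by simp [bitSet]
  rw [h_card]
  clear h_card
  induction K with
  | zero => simp [runSteps]
  | succ K ih =>
    rw [runSteps, weightStep_weight, ih, add_assoc, Fin.sum_univ_castSucc]
    rfl

theorem runSteps_weightStep_reg {v : Var} (hv : v ∉ measureWeight.written) {K : ℕ}
    (w : Fin K → Bool) (c : Config n) : (runSteps weightStep K w c).reg v = c.reg v := by
  refine runSteps_reg (fun k b c => ?_) K w c
  simp only [measureWeight, Prog.written, Finset.mem_insert, Finset.mem_union,
    Finset.mem_singleton, not_or] at hv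
  simp [weightStep, Config.collapse, hv]

theorem expect_recordWeight (c : Config n) (Φ : ℝ → ℝ → ℝ≥0∞) :
    expect (recordWeight.exec f c) (fun c' => Φ (c'.reg .found) (c'.reg .total)) =
      if c.reg .found + 1 ≤ c.reg .m2
      then Φ (c.reg .found + 1) (c.reg .total + c.reg .weight)
      else Φ (c.reg .found) (c.reg .total) := by
  rw [recordWeight, Prog.exec]
  simp only [Config.val, CExpr.eval_add, CExpr.eval_var, CExpr.eval_ofNat, Nat.cast_one]
  split_ifs <;> simp [Prog.exec, Config.val]

theorem sqNorm_mul_expect_measureWeight (hn : c.reg .n = n) {b : Bool} {ψ : Amp n}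
    (hψ : c.psi = project (Fin.last n) b ψ) (φ : Config n → ℝ≥0∞) :
    (sqNorm c.psi : ℝ≥0∞) * expect (measureWeight.exec f c) φ =
      ∑ w, ((‖ψ (Fin.snoc w b)‖₊ ^ 2 : ℝ≥0) : ℝ≥0∞) *
        φ (runSteps weightStep n w (c.tick 2)) := by
  rw [measureWeight, Prog.exec, Config.idx_var_of_eq hn]
  refine (sqNorm_mul_expect_iterateM (c := c.tick 2) (fun k hk c => exec_measureWeight_body hk c)
    (fun k hk b c => weightStep_psi hk b c) le_rfl φ).trans ?_
  simp_rw [sqNorm_runSteps (c := c.tick 2) (fun _ hk b c => weightStep_psi hk b c) _ hψ]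

theorem sqNorm_mul_expect_measureWeight_recordWeight (hn : c.reg .n = n) {b : Bool} {ψ : Amp n}
    (hψ : c.psi = project (Fin.last n) b ψ) (Φ : ℝ → ℝ → ℝ≥0∞) :
    (sqNorm c.psi : ℝ≥0∞) *
      expect ((Prog.assign .weight 0;; measureWeight;; recordWeight).exec f c)
        (fun c' => Φ (c'.reg .found) (c'.reg .total)) =
    ∑ w, ((‖ψ (Fin.snoc w b)‖₊ ^ 2 : ℝ≥0) : ℝ≥0∞) *
      if c.reg .found + 1 ≤ c.reg .m2
      then Φ (c.reg .found + 1) (c.reg .total + (bitSet w).card)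
      else Φ (c.reg .found) (c.reg .total) := by
  have h_written : .found ∉ measureWeight.written ∧ .total ∉ measureWeight.written ∧
      .m2 ∉ measureWeight.written := by decide
  rw [expect_exec_seq, Prog.exec, expect_pure, expect_exec_seq]
  refine (sqNorm_mul_expect_measureWeight (c := (c.set .weight (c.val 0)).tick 2) hn hψ _).trans ?_
  simp_rw [expect_recordWeight, runSteps_weightStep_reg h_written.1,
    runSteps_weightStep_reg h_written.2.1, runSteps_weightStep_reg h_written.2.2,
    runSteps_weightStep_weight]
  simp [Config.val]

/-- The distribution of the set measured in Fourier sampling, which has the squared Fourier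
coefficients of `(-1)^f` as probabilities. -/
noncomputable def fourierPMF (f : (Fin n → Bool) → Bool) : PMF (Finset (Fin n)) :=
  PMF.ofFintype (fun S => ENNReal.ofReal (cubeFourier (signFn f) S ^ 2)) <| by
    rw [← ENNReal.ofReal_sum_of_nonneg fun S _ => sq_nonneg _, sum_cubeFourier_signFn_sq,
      ENNReal.ofReal_one]

theorem mean_fourierPMF_card (f : (Fin n → Bool) → Bool) :
    (mean (fourierPMF f) fun S => (S.card : ℝ)) = totalInfluence (signFn f) := by
  rw [← sum_cubeFourier_sq_mul_card]
  simp [mean, fourierPMF, ENNReal.toReal_ofReal, sq_nonneg]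

theorem coe_nnnorm_hadamardState_sq (f : (Fin n → Bool) → Bool) (w : Fin n → Bool) :
    ((‖hadamardState (n + 1) (functionState f) (Fin.snoc w true)‖₊ ^ 2 : ℝ≥0) : ℝ≥0∞) =
      ENNReal.ofReal (1 / 2) * fourierPMF f (bitSet w) := by
  have h_sign : (fun x => hadamardSign true (f x)) = signFn f := (funext (signFn_eq f)).symm
  rw [hadamardState_functionState_snoc, coe_nnnorm_ofReal_sq, h_sign, fourierPMF,
    PMF.ofFintype_apply, ← ENNReal.ofReal_mul (by positivity), div_pow, Real.sq_sqrt zero_le_two,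
    one_div_mul_eq_div]

theorem expect_measureSet (hn : c.reg .n = n)
    (hψ : c.psi = hadamardState (n + 1) (functionState f)) (Φ : ℝ → ℝ → ℝ≥0∞) :
    expect (measureSet.exec f c) (fun c' => Φ (c'.reg .found) (c'.reg .total)) =
      ENNReal.ofReal (1 / 2) * Φ (c.reg .found) (c.reg .total) +
        ENNReal.ofReal (1 / 2) * expect (fourierPMF f) fun S =>
          if c.reg .found + 1 ≤ c.reg .m2
          then Φ (c.reg .found + 1) (c.reg .total + S.card)
          else Φ (c.reg .found) (c.reg .total) := by
  have h_idx : c.idx Var.n = n := Config.idx_var_of_eq hn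
  rw [← one_mul (expect (measureSet.exec f c) _), ← sqNorm_hadamardState f, ← hψ, measureSet,
    expect_exec_seq, Prog.exec, h_idx, CExpr.cost_var]
  refine (sqNorm_mul_expect_measure (c := c.tick 2) n.lt_succ_self _ _).trans ?_
  rw [Fintype.sum_bool, add_comm]
  change (sqNorm (project (Fin.last n) false c.psi) : ℝ≥0∞) * _ +
    (sqNorm (project (Fin.last n) true c.psi) : ℝ≥0∞) * _ = _
  congr 1
  · rw [Prog.exec, if_neg (by simp [Config.val, Config.collapse]), hψ,
      sqNorm_project_last_hadamardState]
    simp [Prog.exec, Config.collapse]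
  · rw [Prog.exec, if_pos (by simp [Config.val, Config.collapse])]
    refine (sqNorm_mul_expect_measureWeight_recordWeight
      (c := ((c.tick 2).collapse (Fin.last n) .label true).tick 3) hn rfl Φ).trans ?_
    rw [Config.psi_tick, hψ]
    simp only [coe_nnnorm_hadamardState_sq, mul_assoc, ← Finset.mul_sum, expect_eq_sum,
      ← sum_bitSet]
    simp [Config.collapse]

theorem expect_fourierAttempt (hn : c.reg .n = n) (Φ : ℝ → ℝ → ℝ≥0∞) :
    expect (fourierAttempt.exec f c) (fun c' => Φ (c'.reg .found) (c'.reg .total)) =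
      ENNReal.ofReal (1 / 2) * Φ (c.reg .found) (c.reg .total) +
        ENNReal.ofReal (1 / 2) * expect (fourierPMF f) fun S =>
          if c.reg .found + 1 ≤ c.reg .m2
          then Φ (c.reg .found + 1) (c.reg .total + S.card)
          else Φ (c.reg .found) (c.reg .total) := by
  rw [fourierAttempt_eq, expect_exec_seq, expect_exec_fresh, expect_exec_seq,
    ← expect_const (hadamardAll.exec f (c.load f)) (_ + _)]
  refine expect_congr fun c' hc' => ?_
  have h_reg : ∀ v ∉ hadamardAll.written, c'.reg v = c.reg v := fun v hv =>
    Prog.reg_eq_of_notMem_written (c := c.load f) hv hc'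
  rw [expect_measureSet ((h_reg .n (by decide)).trans hn)
    (psi_of_mem_support_hadamardAll (c := c.load f) hn hc'), h_reg .found (by decide),
    h_reg .total (by decide), h_reg .m2 (by decide)]

end FourierAttempt

/-! ## The law of a classical sample -/

section ClassicalSample

open scoped ENNReal

variable {n : ℕ} {f : (Fin n → Bool) → Bool} {c : Config n}

open Prog CExpr in
/-- The part of `classicalSample` that measures `x` and adds the signs `(-1)^{x_i + f(x)}` to the
memory, the bit `f(x)` being stored in `label`. -/
def measureSigns : Prog :=
  loop .i Var.n
    (meas Var.i .bit;;
      store Var.i (arr Var.i + (1 - 2 * Var.bit) * (1 - 2 * Var.label)))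

theorem classicalSample_eq :
    classicalSample = (Prog.fresh;; Prog.meas Var.n .label;; measureSigns) := rfl

/-- One pass through the loop of `measureSigns`, with measurement outcome `b`. -/
noncomputable def signStep (k : ℕ) (b : Bool) (c : Config n) : Config n :=
  let c' := ((c.set .i k).tick 3).collapse (Fin.ofNat (n + 1) k) .bit b
  { c'.tick 16 with
    mem := Function.update c'.mem k
      (c'.mem k + (1 - 2 * c'.reg .bit) * (1 - 2 * c'.reg .label)) }

theorem exec_measureSigns_body {k : ℕ} (hk : k < n + 1) (c : Config n) :
    (Prog.meas Var.i .bit;;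
        .store Var.i (.arr Var.i + (1 - 2 * Var.bit) * (1 - 2 * Var.label))).exec f
      ((c.set .i k).tick 1) = (bornPMF ⟨k, hk⟩ c.psi).map (signStep k · c) := by
  rw [Prog.exec, Prog.exec, Config.idx_var_of_eq (k := k) (by simp), Config.measure_of_lt _ hk,
    PMF.bind_map]
  simp only [signStep, ofNat_eq_mk hk]
  refine congrArg _ (funext fun b => ?_)
  simp [Prog.exec, Config.idx, Config.val, Config.collapse, Config.tick, Config.set, add_assoc]

theorem signStep_psi {k : ℕ} (hk : k < n + 1) (b : Bool) (c : Config n) :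
    (signStep k b c).psi = project ⟨k, hk⟩ b c.psi := by
  rw [← ofNat_eq_mk hk]
  rfl

theorem signStep_label (k : ℕ) (b : Bool) (c : Config n) :
    (signStep k b c).reg .label = c.reg .label := by
  simp [signStep, Config.collapse]

theorem one_sub_two_mul_ite (b : Bool) : 1 - 2 * (if b then (1 : ℝ) else 0) = bitSign b := by
  cases b <;> norm_num

theorem signStep_mem (k : ℕ) (b : Bool) (c : Config n) :
    (signStep k b c).mem =
      Function.update c.mem k (c.mem k + bitSign b * (1 - 2 * c.reg .label)) := by
  simp [signStep, Config.collapse, ← one_sub_two_mul_ite]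

theorem runSteps_signStep_mem {K : ℕ} (w : Fin K → Bool) (c : Config n) (i : Fin K) :
    (runSteps signStep K w c).mem i = c.mem i + bitSign (w i) * (1 - 2 * c.reg .label) := by
  have h_later : ∀ {K : ℕ} (w : Fin K → Bool), ∀ m ≥ K,
      (runSteps signStep K w c).mem m = c.mem m := by
    intro K w m hm
    induction K with
    | zero => rfl
    | succ K ih =>
      rw [runSteps, signStep_mem, Function.update_of_ne (by omega), ih _ (by omega)]
  induction K with
  | zero => exact i.elim0
  | succ K ih =>
    rw [runSteps, signStep_mem, runSteps_reg signStep_label]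
    cases i using Fin.lastCases with
    | last => rw [Fin.val_last, Function.update_self, h_later _ _ le_rfl]
    | cast i => rw [Fin.val_castSucc, Function.update_of_ne i.is_lt.ne, ih]; rfl

theorem sqNorm_mul_expect_measureSigns (hn : c.reg .n = n) {b : Bool} {ψ : Amp n}
    (hψ : c.psi = project (Fin.last n) b ψ) (i : Fin n) (Φ : ℝ → ℝ≥0∞) :
    (sqNorm c.psi : ℝ≥0∞) * expect (measureSigns.exec f c) (fun c' => Φ (c'.mem i)) =
      ∑ x, ((‖ψ (Fin.snoc x b)‖₊ ^ 2 : ℝ≥0) : ℝ≥0∞) *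
        Φ (c.mem i + bitSign (x i) * (1 - 2 * c.reg .label)) := by
  rw [measureSigns, Prog.exec, Config.idx_var_of_eq hn]
  refine (sqNorm_mul_expect_iterateM (c := c.tick 2) (fun k hk c => exec_measureSigns_body hk c)
    (fun k hk b c => signStep_psi hk b c) le_rfl _).trans ?_
  simp_rw [sqNorm_runSteps (c := c.tick 2) (fun _ hk b c => signStep_psi hk b c) _ hψ,
    runSteps_signStep_mem]
  rfl

theorem expect_classicalSample (hn : c.reg .n = n) (i : Fin n) (Φ : ℝ → ℝ≥0∞) :
    expect (classicalSample.exec f c) (fun c' => Φ (c'.mem i)) =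
      expect (PMF.uniformOfFintype (Fin n → Bool)) fun x =>
        Φ (c.mem i + bitSign (x i) * bitSign (f x)) := by
  have h_idx : (c.load f).idx Var.n = n := Config.idx_var_of_eq hn
  rw [classicalSample_eq, expect_exec_seq, expect_exec_fresh, expect_exec_seq, Prog.exec, h_idx,
    CExpr.cost_var, ← one_mul (expect _ _), ← sqNorm_functionState f]
  refine (sqNorm_mul_expect_measure (c := (c.load f).tick 2) n.lt_succ_self _ _).trans ?_
  have h_branch := fun b => sqNorm_mul_expect_measureSigns (f := f)
    (c := ((c.load f).tick 2).collapse (Fin.last n) .label b) (hn := by simpa [Config.collapse])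
    (ψ := functionState f) (b := b) rfl i Φ
  refine (Finset.sum_congr rfl fun b _ => h_branch b).trans ?_
  rw [Finset.sum_comm, expect_eq_sum]
  refine Finset.sum_congr rfl fun x _ => ?_
  have h_uniform : PMF.uniformOfFintype (Fin n → Bool) x = ENNReal.ofReal (1 / 2 ^ n) := by
    rw [PMF.uniformOfFintype_apply, one_div, ENNReal.ofReal_inv_of_pos (by positivity)]
    simp
  simp only [nnnorm_functionState_snoc_sq, ite_mul, zero_mul, Finset.sum_ite_eq',
    Finset.mem_univ, if_true, h_uniform]
  simp [Config.collapse, Config.load, ← one_sub_two_mul_ite (f x)]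

end ClassicalSample

/-! ## Concentration of the estimates -/

section Potential

open scoped ENNReal

variable {n : ℕ} {f : (Fin n → Bool) → Bool}

theorem triple_loop_of_expect_le {v : Var} {e : CExpr} {p : Prog} {P Q I : Config n → Prop}
    {Φ : Config n → ℝ≥0∞} {K : ℕ} {r w : ℝ≥0∞}
    (h_init : ∀ c, P c → c.idx e = K ∧ I (c.tick (1 + e.cost)) ∧ Φ (c.tick (1 + e.cost)) ≤ 1)
    (h_set : ∀ (k : ℕ) c, I c → I ((c.set v k).tick 1) ∧ Φ ((c.set v k).tick 1) = Φ c)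
    (h_inv : Triple f I p I 0) (h_pot : ∀ c, I c → expect (p.exec f c) Φ ≤ r * Φ c)
    (h_post : ∀ c, I c → ¬ Q c → 1 ≤ w * Φ c) :
    Triple f P (.loop v e p) Q (w * r ^ K) := by
  intro c hc
  obtain ⟨h_idx, hI, hΦ⟩ := h_init c hc
  rw [Prog.exec, h_idx]
  refine (toOuterMeasure_iterateM_le (I := I) (Φ := Φ) (r := r)
    (fun k c hc c' hc' => triple_zero_iff.mp h_inv _ (h_set k c hc).1 c' hc')
    (fun k c hc => (h_pot _ (h_set k c hc).1).trans_eq (by rw [(h_set k c hc).2]))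
    (fun c hc hI => h_post c hI hc) hI K).trans ?_
  gcongr
  exact mul_le_of_le_one_right' hΦ

theorem one_le_eexp_neg_mul_eexp {x y : ℝ} (h : x ≤ y) : 1 ≤ eexp (-x) * eexp y := by
  rw [← eexp_add]
  exact one_le_eexp (by linarith)

end Potential

section FourierLoop

open scoped ENNReal

variable {n M m : ℕ} {f : (Fin n → Bool) → Bool} {c : Config n}

/-- The invariant of the Fourier sampling loop when `M` sets are to be recorded. -/
structure FourierInvariant (M : ℕ) (c : Config n) : Prop where
  n_eq : c.reg .n = n
  m2_eq : c.reg .m2 = M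
  found_eq : ∃ k ≤ M, c.reg .found = k

/-- The precondition of the Fourier sampling loop when it makes `m` attempts at recording `M`
sets. -/
structure FourierStart (M m : ℕ) (c : Config n) : Prop where
  n_eq : c.reg .n = n
  m2_eq : c.reg .m2 = M
  m1_eq : c.reg .m1 = m
  found_eq : c.reg .found = 0
  total_eq : c.reg .total = 0

theorem FourierInvariant.set_tick (h : FourierInvariant M c) (k : ℕ) :
    FourierInvariant M ((c.set .ell k).tick 1) :=
  ⟨by simpa using h.n_eq, by simpa using h.m2_eq, by simpa using h.found_eq⟩

theorem FourierStart.invariant (h : FourierStart M m c) (k : ℕ) : FourierInvariant M (c.tick k) :=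
  ⟨h.n_eq, h.m2_eq, 0, M.zero_le, by simpa using h.found_eq⟩

theorem triple_fourierAttempt_invariant :
    Triple f (FourierInvariant M) fourierAttempt (FourierInvariant M) 0 := by
  classical
  intro c hc
  obtain ⟨k, hk, h_found⟩ := hc.found_eq
  let Φ : ℝ → ℝ → ℝ≥0∞ := fun F _ => if ∃ k ≤ M, F = (k : ℕ) then 0 else 1
  refine (toOuterMeasure_le_expect (φ := fun c' => Φ (c'.reg .found) (c'.reg .total))
    fun c' hc' h_not => ?_).trans_eq ?_
  · have h_n := Prog.reg_eq_of_notMem_written (v := .n) (by decide) hc'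
    have h_m2 := Prog.reg_eq_of_notMem_written (v := .m2) (by decide) hc'
    exact (if_neg fun h => h_not ⟨h_n.trans hc.n_eq, h_m2.trans hc.m2_eq, h⟩).ge
  · have h_same : Φ k (c.reg .total) = 0 := if_pos ⟨k, hk, rfl⟩
    rw [expect_fourierAttempt hc.n_eq, h_found, hc.m2_eq, h_same, mul_zero, zero_add]
    split_ifs with h_le
    · have h_succ : ∀ T, Φ (k + 1) T = 0 := fun _ =>
        if_pos ⟨k + 1, by exact_mod_cast h_le, by push_cast; rfl⟩
      simp_rw [h_succ, expect_const, mul_zero]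
    · rw [expect_const, mul_zero]

theorem half_add_half_mul (x : ℝ≥0∞) :
    ENNReal.ofReal (1 / 2) * x + ENNReal.ofReal (1 / 2) * x = x := by
  rw [← add_mul, ← ENNReal.ofReal_add (by norm_num) (by norm_num)]
  norm_num

/-- The exponential supermartingale that controls the total size `T` of the first `F` recorded
sets. -/
noncomputable def weightPotential (f : (Fin n → Bool) → Bool) (t F T : ℝ) : ℝ≥0∞ :=
  eexp (t * (T - F * totalInfluence (signFn f)) - F * (t ^ 2 * n ^ 2 / 8))

theorem expect_weightPotential_le (f : (Fin n → Bool) → Bool) (t F T : ℝ) :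
    (expect (fourierPMF f) fun S => weightPotential f t (F + 1) (T + S.card)) ≤
      weightPotential f t F T := by
  have h_card : ∀ S : Finset (Fin n), (S.card : ℝ) ∈ Set.Icc 0 (n : ℝ) := fun S =>
    ⟨by positivity, by exact_mod_cast card_finset_fin_le S⟩
  have h_hoeffding := expect_eexp_mul_le_of_mem_Icc (fourierPMF f) h_card t
  rw [mean_fourierPMF_card, sub_zero] at h_hoeffding
  set I := totalInfluence (signFn f) with hI
  have h_split : ∀ S : Finset (Fin n), weightPotential f t (F + 1) (T + S.card) =
      weightPotential f t F T * eexp (-(t * I + t ^ 2 * n ^ 2 / 8)) * eexp (t * S.card) := by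
    intro S
    simp only [weightPotential, ← eexp_add, ← hI]
    ring_nf
  simp_rw [h_split, expect_const_mul]
  calc weightPotential f t F T * eexp (-(t * I + t ^ 2 * n ^ 2 / 8)) *
        expect (fourierPMF f) (fun S => eexp (t * S.card))
      ≤ weightPotential f t F T * eexp (-(t * I + t ^ 2 * n ^ 2 / 8)) *
        eexp (t * I + t ^ 2 * n ^ 2 / 8) := by gcongr
    _ = weightPotential f t F T := by
        rw [mul_assoc, ← eexp_add, neg_add_cancel, eexp_zero, mul_one]

theorem expect_fourierAttempt_weightPotential_le (t : ℝ) (hn : c.reg .n = n) :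
    expect (fourierAttempt.exec f c)
        (fun c' => weightPotential f t (c'.reg .found) (c'.reg .total)) ≤
      weightPotential f t (c.reg .found) (c.reg .total) := by
  rw [expect_fourierAttempt hn]
  split_ifs
  · refine (add_le_add_right (mul_le_mul_right (expect_weightPotential_le f t _ _) _) _).trans_eq ?_
    exact half_add_half_mul _
  · rw [expect_const, half_add_half_mul]

theorem triple_fourierLoop_weight (t x : ℝ) :
    Triple f (FourierStart M m) (.loop .ell Var.m1 fourierAttempt)
      (fun c => c.reg .found = M →
        t * (c.reg .total - M * totalInfluence (signFn f)) ≤ M * (t ^ 2 * n ^ 2 / 8) + x)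
      (eexp (-x)) := by
  refine (triple_loop_of_expect_le (I := FourierInvariant M) (K := m) (r := 1) (w := eexp (-x))
    (Φ := fun c => weightPotential f t (c.reg .found) (c.reg .total)) (fun c hc => ?_)
    (fun k c hc => ⟨hc.set_tick k, by simp⟩) triple_fourierAttempt_invariant (fun c hc => ?_)
    (fun c _ h_not => ?_)).mono (fun _ => id) (fun _ => id) (by rw [one_pow, mul_one])
  · refine ⟨Config.idx_var_of_eq hc.m1_eq, hc.invariant _, ?_⟩
    simp [weightPotential, hc.found_eq, hc.total_eq]
  · rw [one_mul]
    exact expect_fourierAttempt_weightPotential_le t hc.n_eq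
  · push Not at h_not
    rw [weightPotential, h_not.1]
    exact one_le_eexp_neg_mul_eexp (by linarith [h_not.2])

/-- The exponential potential that controls the number `F` of recorded sets until it reaches
`M`. -/
noncomputable def countPotential (M : ℕ) (F : ℝ) : ℝ≥0∞ :=
  if F = M then 0 else eexp (-(2 / 3 * F))

theorem half_mul_one_add_eexp_le :
    ENNReal.ofReal (1 / 2) * (1 + eexp (-(2 / 3))) ≤ eexp (-(5 / 18)) := by
  have h_cosh : (1 + Real.exp (-(2 / 3))) / 2 = Real.exp (-(1 / 3)) * Real.cosh (1 / 3) := by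
    rw [Real.cosh_eq, mul_div_assoc', mul_add, ← Real.exp_add, ← Real.exp_add]
    norm_num
  rw [eexp, ← ENNReal.ofReal_one, ← ENNReal.ofReal_add zero_le_one (Real.exp_nonneg _),
    ← ENNReal.ofReal_mul (by norm_num)]
  refine ENNReal.ofReal_le_ofReal ?_
  calc 1 / 2 * (1 + Real.exp (-(2 / 3)))
      = Real.exp (-(1 / 3)) * Real.cosh (1 / 3) := by rw [one_div_mul_eq_div, h_cosh]
    _ ≤ Real.exp (-(1 / 3)) * Real.exp ((1 / 3) ^ 2 / 2) := by
        gcongr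
        exact Real.cosh_le_exp_half_sq _
    _ = Real.exp (-(5 / 18)) := by
        rw [← Real.exp_add]
        norm_num

theorem expect_fourierAttempt_countPotential_le (hc : FourierInvariant M c) :
    expect (fourierAttempt.exec f c) (fun c' => countPotential M (c'.reg .found)) ≤
      eexp (-(5 / 18)) * countPotential M (c.reg .found) := by
  rw [expect_fourierAttempt hc.n_eq fun F _ => countPotential M F]
  obtain ⟨k, hk, h_found⟩ := hc.found_eq
  rw [hc.m2_eq, h_found]
  rcases hk.lt_or_eq with h_lt | rfl
  · have h_succ : countPotential M (k + 1) ≤ eexp (-(2 / 3)) * eexp (-(2 / 3 * k)) := by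
      unfold countPotential
      split_ifs
      · exact zero_le
      · rw [← eexp_add]
        exact eexp_mono (by linarith)
    have h_self : countPotential M k = eexp (-(2 / 3 * k)) := if_neg (by exact_mod_cast h_lt.ne)
    rw [if_pos (by exact_mod_cast h_lt), expect_const, ← mul_add, h_self]
    calc ENNReal.ofReal (1 / 2) * (eexp (-(2 / 3 * k)) + countPotential M (k + 1))
        ≤ ENNReal.ofReal (1 / 2) * (eexp (-(2 / 3 * k)) + eexp (-(2 / 3)) * eexp (-(2 / 3 * k))) :=
          by gcongr
      _ = ENNReal.ofReal (1 / 2) * (1 + eexp (-(2 / 3))) * eexp (-(2 / 3 * k)) := by ring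
      _ ≤ eexp (-(5 / 18)) * eexp (-(2 / 3 * k)) := by
          gcongr
          exact half_mul_one_add_eexp_le
  · simp [countPotential, expect_const]

theorem triple_fourierLoop_found (hm : 3 * M ≤ m) :
    Triple f (FourierStart M m) (.loop .ell Var.m1 fourierAttempt) (fun c => c.reg .found = M)
      (eexp (-(m / 18))) := by
  have h_rate : eexp (2 / 3 * M) * eexp (-(5 / 18)) ^ m ≤ eexp (-(m / 18)) := by
    have hm' : (3 : ℝ) * M ≤ m := by exact_mod_cast hm
    rw [eexp_pow, ← eexp_add]
    exact eexp_mono (by linarith)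
  refine (triple_loop_of_expect_le (I := FourierInvariant M)
    (Φ := fun c => countPotential M (c.reg .found)) (fun c hc => ?_)
    (fun k c hc => ⟨hc.set_tick k, by simp⟩) triple_fourierAttempt_invariant
    (fun c hc => expect_fourierAttempt_countPotential_le hc) (fun c hc h_not => ?_)).mono
    (fun _ => id) (fun _ => id) h_rate
  · refine ⟨Config.idx_var_of_eq hc.m1_eq, hc.invariant _, ?_⟩
    simp only [Config.reg_tick, hc.found_eq, countPotential]
    split_ifs <;> simp
  · obtain ⟨k, hk, h_found⟩ := hc.found_eq
    have hk' : (k : ℝ) ≤ M := by exact_mod_cast hk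
    rw [countPotential, if_neg h_not, h_found, ← eexp_add]
    exact one_le_eexp (by linarith)

theorem triple_fourierLoop (hn : 0 < n) (hM : 0 < M) (hm : 3 * M ≤ m) {e : ℝ} (he : 0 < e) :
    Triple f (FourierStart M m) (.loop .ell Var.m1 fourierAttempt)
      (fun c => |c.reg .total / M - totalInfluence (signFn f)| ≤ e)
      (eexp (-(m / 18)) + (eexp (-(2 * M * e ^ 2 / n ^ 2)) + eexp (-(2 * M * e ^ 2 / n ^ 2)))) := by
  have : (0 : ℝ) < n := by exact_mod_cast hn
  have hM' : (0 : ℝ) < M := by exact_mod_cast hM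
  have ht : 0 < 4 * e / n ^ 2 := by positivity
  refine ((triple_fourierLoop_found hm).and ((triple_fourierLoop_weight (4 * e / n ^ 2) _).and
    (triple_fourierLoop_weight (-(4 * e / n ^ 2)) _))).mono (fun _ => id) (fun c hc => ?_) le_rfl
  obtain ⟨h_found, h_upper, h_lower⟩ := hc
  have h_bound : M * ((4 * e / n ^ 2) ^ 2 * (n : ℝ) ^ 2 / 8) + 2 * M * e ^ 2 / n ^ 2 =
      4 * e / n ^ 2 * (M * e) := by
    field_simp
    ring
  have h_upper := h_upper h_found
  have h_lower := h_lower h_found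
  rw [h_bound, mul_le_mul_iff_right₀ ht] at h_upper
  rw [neg_sq, h_bound, neg_mul_comm, mul_le_mul_iff_right₀ ht] at h_lower
  rw [div_sub' hM'.ne', abs_div, abs_of_pos hM', div_le_iff₀ hM', mul_comm e, abs_le]
  constructor <;> linarith

end FourierLoop

section SampleLoop

open scoped ENNReal

variable {n m : ℕ} {f : (Fin n → Bool) → Bool} {c : Config n}

/-- The precondition of the sampling loop for the `i`-th degree-one Fourier coefficient when it
takes `m` samples. -/
structure SampleStart (m : ℕ) (i : Fin n) (c : Config n) : Prop where
  n_eq : c.reg .n = n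
  m5_eq : c.reg .m5 = m
  mem_eq : c.mem i = 0

theorem mean_bitSign_mul_bitSign (f : (Fin n → Bool) → Bool) (i : Fin n) :
    (mean (PMF.uniformOfFintype (Fin n → Bool)) fun x => bitSign (x i) * bitSign (f x)) =
      cubeFourier (signFn f) {i} := by
  rw [cubeFourier_singleton, funext (signFn_eq f)]
  simp [mean, cubeExp, Finset.mul_sum, mul_comm, div_eq_mul_inv]

theorem expect_classicalSample_eexp_le (t : ℝ) (hn : c.reg .n = n) (i : Fin n) :
    expect (classicalSample.exec f c) (fun c' => eexp (t * c'.mem i)) ≤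
      eexp (t * cubeFourier (signFn f) {i} + t ^ 2 / 2) * eexp (t * c.mem i) := by
  have h_sign : ∀ x, bitSign (x i) * bitSign (f x) ∈ Set.Icc (-1 : ℝ) 1 := fun x => by
    cases x i <;> cases f x <;> simp
  have h_hoeffding := expect_eexp_mul_le_of_mem_Icc (PMF.uniformOfFintype (Fin n → Bool)) h_sign t
  rw [mean_bitSign_mul_bitSign] at h_hoeffding
  simp_rw [expect_classicalSample hn i fun x => eexp (t * x), mul_add, eexp_add (t * c.mem i),
    expect_const_mul, mul_comm (eexp (t * c.mem i))]
  gcongr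
  exact h_hoeffding.trans_eq (by ring_nf)

theorem triple_sampleLoop_of_exponent (i : Fin n) (t x : ℝ) :
    Triple f (SampleStart m i) (.loop .ell Var.m5 classicalSample)
      (fun c => t * (c.mem i - m * cubeFourier (signFn f) {i}) ≤ m * (t ^ 2 / 2) + x)
      (eexp (-x)) := by
  set μ := t * cubeFourier (signFn f) {i} + t ^ 2 / 2 with hμ
  have h_rate : eexp (-(m * μ + x)) * eexp μ ^ m ≤ eexp (-x) := by
    rw [eexp_pow, ← eexp_add]
    exact eexp_mono (by linarith)
  refine (triple_loop_of_expect_le (I := fun c => c.reg .n = n) (Φ := fun c => eexp (t * c.mem i))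
    (fun c hc => ⟨Config.idx_var_of_eq hc.m5_eq, hc.n_eq, by simp [hc.mem_eq]⟩)
    (fun k c hc => ⟨by simpa using hc, by simp⟩) ?_
    (fun c hc => expect_classicalSample_eexp_le t hc i) (fun c _ h_not => ?_)).mono
    (fun _ => id) (fun _ => id) h_rate
  · exact triple_zero_iff.mpr fun c hc c' hc' =>
      (Prog.reg_eq_of_notMem_written (by decide) hc').trans hc
  · exact one_le_eexp_neg_mul_eexp (by rw [hμ]; linarith)

theorem triple_sampleLoop (hm : 0 < m) (i : Fin n) {e : ℝ} (he : 0 < e) :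
    Triple f (SampleStart m i) (.loop .ell Var.m5 classicalSample)
      (fun c => |c.mem i / m - cubeFourier (signFn f) {i}| ≤ e)
      (eexp (-(m * e ^ 2 / 2)) + eexp (-(m * e ^ 2 / 2))) := by
  have hm' : (0 : ℝ) < m := by exact_mod_cast hm
  refine ((triple_sampleLoop_of_exponent i e _).and (triple_sampleLoop_of_exponent i (-e) _)).mono
    (fun _ => id) (fun c hc => ?_) le_rfl
  obtain ⟨h_upper, h_lower⟩ := hc
  have h_bound : m * (e ^ 2 / 2) + m * e ^ 2 / 2 = e * (m * e) := by ring
  rw [h_bound, mul_le_mul_iff_right₀ he] at h_upper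
  rw [neg_sq, h_bound, neg_mul_comm, mul_le_mul_iff_right₀ he] at h_lower
  rw [div_sub' hm'.ne', abs_div, abs_of_pos hm', div_le_iff₀ hm', mul_comm e, abs_le]
  constructor <;> linarith

end SampleLoop

/-! ## Sample sizes -/

/-- The number of recorded sets that enter the estimate of the total influence; this is the value
`m₂` of the algorithm. -/
noncomputable def setCount (n : ℕ) (ε δ : ℝ) : ℕ :=
  ⌈(n : ℝ) ^ 2 * Real.log (2 / (δ / 3)) / (2 * (ε / 3) ^ 2)⌉₊

/-- The number of copies used for Fourier sampling; this is the value `m₁` of the algorithm. -/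
noncomputable def fourierCount (n : ℕ) (ε δ : ℝ) : ℕ :=
  max (3 * setCount n ε δ) ⌈18 * Real.log (2 / (δ / 3))⌉₊

/-- The number of copies used for classical samples; this is the value `m₅` of the algorithm. -/
noncomputable def sampleCount (n : ℕ) (ε δ : ℝ) : ℕ :=
  ⌈4 * Real.log (2 / (δ / (3 * n))) / (ε / (3 * n)) ^ 2⌉₊

theorem copyCount_eq (n : ℕ) (ε δ : ℝ) :
    copyCount n ε δ = fourierCount n ε δ + sampleCount n ε δ := rfl

section SampleSizes

variable {n : ℕ} {ε δ : ℝ}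

theorem log_two_div_div_three_pos (hδ : 0 < δ) (hδ1 : δ < 1) : 0 < Real.log (2 / (δ / 3)) := by
  apply Real.log_pos
  rw [lt_div_iff₀ (by positivity)]
  linarith

theorem log_two_div_div_three_mul_pos (hn : 1 ≤ n) (hδ : 0 < δ) (hδ1 : δ < 1) :
    0 < Real.log (2 / (δ / (3 * n))) := by
  have hn' : (1 : ℝ) ≤ n := by exact_mod_cast hn
  apply Real.log_pos
  rw [lt_div_iff₀ (by positivity), one_mul, div_lt_iff₀ (by positivity)]
  linarith

theorem setCount_pos (hn : 1 ≤ n) (hε : 0 < ε) (hδ : 0 < δ) (hδ1 : δ < 1) :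
    0 < setCount n ε δ := by
  have h_log := log_two_div_div_three_pos hδ hδ1
  have : (0 : ℝ) < n := by exact_mod_cast hn
  exact Nat.ceil_pos.mpr (by positivity)

theorem sampleCount_pos (hn : 1 ≤ n) (hε : 0 < ε) (hδ : 0 < δ) (hδ1 : δ < 1) :
    0 < sampleCount n ε δ := by
  have h_log := log_two_div_div_three_mul_pos hn hδ hδ1
  have : (0 : ℝ) < n := by exact_mod_cast hn
  exact Nat.ceil_pos.mpr (by positivity)

theorem log_le_setCount_mul (hn : 1 ≤ n) (hε : 0 < ε) :
    Real.log (2 / (δ / 3)) ≤ 2 * setCount n ε δ * (ε / 3) ^ 2 / n ^ 2 := by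
  have : (0 : ℝ) < n := by exact_mod_cast hn
  have h_ceil : (n : ℝ) ^ 2 * Real.log (2 / (δ / 3)) / (2 * (ε / 3) ^ 2) ≤ setCount n ε δ :=
    Nat.le_ceil _
  rw [div_le_iff₀ (by positivity)] at h_ceil
  rw [le_div_iff₀ (by positivity)]
  linarith

theorem log_le_fourierCount_div : Real.log (2 / (δ / 3)) ≤ fourierCount n ε δ / 18 := by
  have h_ceil : 18 * Real.log (2 / (δ / 3)) ≤ fourierCount n ε δ :=
    (Nat.le_ceil _).trans (by exact_mod_cast le_max_right _ _)
  linarith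

theorem log_le_sampleCount_mul (hn : 1 ≤ n) (hε : 0 < ε) (hδ : 0 < δ) (hδ1 : δ < 1) :
    Real.log (2 / (δ / (3 * n))) ≤ sampleCount n ε δ * (ε / (3 * n)) ^ 2 / 2 := by
  have h_log := log_two_div_div_three_mul_pos hn hδ hδ1
  have : (0 : ℝ) < n := by exact_mod_cast hn
  have h_ceil : 4 * Real.log (2 / (δ / (3 * n))) / (ε / (3 * n)) ^ 2 ≤ sampleCount n ε δ :=
    Nat.le_ceil _
  rw [div_le_iff₀ (by positivity)] at h_ceil
  linarith

theorem log_inv_nonneg (hδ : 0 < δ) (hδ1 : δ < 1) : 0 ≤ Real.log (1 / δ) :=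
  Real.log_nonneg ((one_le_div hδ).mpr hδ1.le)

theorem one_le_log_factor (n : ℕ) (hδ : 0 < δ) (hδ1 : δ < 1) :
    1 ≤ 1 + Real.log n + Real.log (1 / δ) := by
  linarith [Real.log_natCast_nonneg n, log_inv_nonneg hδ hδ1]

theorem log_six_le_two : Real.log 6 ≤ 2 := by
  rw [Real.log_le_iff_le_exp (by norm_num), show (2 : ℝ) = 1 + 1 by norm_num, Real.exp_add]
  have h_exp : (2.7 : ℝ) ≤ Real.exp 1 := by linarith [Real.exp_one_gt_d9]
  nlinarith

theorem log_two_div_div_three_mul_le (hn : 1 ≤ n) (hδ : 0 < δ) (hδ1 : δ < 1) :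
    Real.log (2 / (δ / (3 * n))) ≤ 2 * (1 + Real.log n + Real.log (1 / δ)) := by
  have hn' : (0 : ℝ) < n := by exact_mod_cast hn
  have h_split : Real.log (2 / (δ / (3 * n))) = Real.log 6 + Real.log n + Real.log (1 / δ) := by
    rw [← Real.log_mul (by norm_num) hn'.ne', ← Real.log_mul (by positivity) (by positivity)]
    congr 1
    field_simp
    norm_num
  linarith [log_six_le_two, Real.log_natCast_nonneg n, log_inv_nonneg hδ hδ1]

theorem log_two_div_div_three_le (n : ℕ) (hδ : 0 < δ) (hδ1 : δ < 1) :
    Real.log (2 / (δ / 3)) ≤ 2 * (1 + Real.log n + Real.log (1 / δ)) := by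
  have h_one := log_two_div_div_three_mul_le le_rfl hδ hδ1
  norm_num only [Nat.cast_one, mul_one, Real.log_one] at h_one
  linarith [Real.log_natCast_nonneg n]

theorem log_factor_le_copyScale (hn : 1 ≤ n) (hε : 0 < ε) (hε1 : ε < 1) (hδ : 0 < δ)
    (hδ1 : δ < 1) : 1 + Real.log n + Real.log (1 / δ) ≤
      n ^ 2 * (1 + Real.log n + Real.log (1 / δ)) / ε ^ 2 := by
  have hn' : (1 : ℝ) ≤ n := by exact_mod_cast hn
  have h_log := one_le_log_factor n hδ hδ1
  have h_sq : ε ^ 2 ≤ n ^ 2 := (pow_le_one₀ hε.le hε1.le).trans (one_le_pow₀ hn')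
  rw [le_div_iff₀ (by positivity), mul_comm]
  exact mul_le_mul_of_nonneg_right h_sq (by linarith)

theorem setCount_le (hn : 1 ≤ n) (hε : 0 < ε) (hε1 : ε < 1) (hδ : 0 < δ) (hδ1 : δ < 1) :
    (setCount n ε δ : ℝ) ≤ 10 * (n ^ 2 * (1 + Real.log n + Real.log (1 / δ)) / ε ^ 2) := by
  have h_log := log_two_div_div_three_pos hδ hδ1
  have h_ceil : (setCount n ε δ : ℝ) <
      n ^ 2 * Real.log (2 / (δ / 3)) / (2 * (ε / 3) ^ 2) + 1 :=
    Nat.ceil_lt_add_one (by positivity)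
  have h_arg : (n : ℝ) ^ 2 * Real.log (2 / (δ / 3)) / (2 * (ε / 3) ^ 2) ≤
      9 * (n ^ 2 * (1 + Real.log n + Real.log (1 / δ)) / ε ^ 2) :=
    calc _ ≤ (n : ℝ) ^ 2 * (2 * (1 + Real.log n + Real.log (1 / δ))) / (2 * (ε / 3) ^ 2) := by
          gcongr
          exact log_two_div_div_three_le n hδ hδ1
      _ = _ := by
          field_simp
          ring
  linarith [log_factor_le_copyScale hn hε hε1 hδ hδ1, one_le_log_factor n hδ hδ1]

theorem fourierCount_le (hn : 1 ≤ n) (hε : 0 < ε) (hε1 : ε < 1) (hδ : 0 < δ) (hδ1 : δ < 1) :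
    (fourierCount n ε δ : ℝ) ≤ 37 * (n ^ 2 * (1 + Real.log n + Real.log (1 / δ)) / ε ^ 2) := by
  have h_log := log_two_div_div_three_pos hδ hδ1
  have h_scale := log_factor_le_copyScale hn hε hε1 hδ hδ1
  have h_one := one_le_log_factor n hδ hδ1
  have h_ceil := Nat.ceil_lt_add_one (show 0 ≤ 18 * Real.log (2 / (δ / 3)) by positivity)
  rw [fourierCount, Nat.cast_max, Nat.cast_mul, Nat.cast_ofNat]
  refine max_le ?_ ?_
  · linarith [setCount_le hn hε hε1 hδ hδ1]
  · linarith [log_two_div_div_three_le n hδ hδ1]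

theorem sampleCount_le (hn : 1 ≤ n) (hε : 0 < ε) (hε1 : ε < 1) (hδ : 0 < δ) (hδ1 : δ < 1) :
    (sampleCount n ε δ : ℝ) ≤ 73 * (n ^ 2 * (1 + Real.log n + Real.log (1 / δ)) / ε ^ 2) := by
  have : (0 : ℝ) < n := by exact_mod_cast hn
  have h_log := log_two_div_div_three_mul_pos hn hδ hδ1
  have h_ceil : (sampleCount n ε δ : ℝ) <
      4 * Real.log (2 / (δ / (3 * n))) / (ε / (3 * n)) ^ 2 + 1 :=
    Nat.ceil_lt_add_one (by positivity)
  have h_arg : 4 * Real.log (2 / (δ / (3 * n))) / (ε / (3 * n)) ^ 2 ≤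
      72 * (n ^ 2 * (1 + Real.log n + Real.log (1 / δ)) / ε ^ 2) :=
    calc _ ≤ 4 * (2 * (1 + Real.log n + Real.log (1 / δ))) / (ε / (3 * n)) ^ 2 := by
          gcongr
          exact log_two_div_div_three_mul_le hn hδ hδ1
      _ = _ := by
          field_simp
          ring
  linarith [log_factor_le_copyScale hn hε hε1 hδ hδ1, one_le_log_factor n hδ hδ1]

theorem copyCount_le (hn : 1 ≤ n) (hε : 0 < ε) (hε1 : ε < 1) (hδ : 0 < δ) (hδ1 : δ < 1) :
    (copyCount n ε δ : ℝ) ≤ 110 * (n ^ 2 * (1 + Real.log n + Real.log (1 / δ)) / ε ^ 2) := by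
  rw [copyCount_eq, Nat.cast_add]
  linarith [fourierCount_le hn hε hε1 hδ hδ1, sampleCount_le hn hε hε1 hδ hδ1]

theorem log_factor_le_of_le_half (n : ℕ) (hδ : 0 < δ) (hδ2 : δ ≤ 1 / 2) :
    1 + Real.log n + Real.log (1 / δ) ≤ 3 * ((1 + Real.log n) * Real.log (1 / δ)) := by
  have h_n : 0 ≤ Real.log n := Real.log_natCast_nonneg n
  have h_two : Real.log 2 ≤ Real.log (1 / δ) :=
    Real.log_le_log two_pos ((le_div_iff₀ hδ).mpr (by linarith))
  nlinarith [Real.log_two_gt_d9]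

theorem copyCount_le_of_le_half (hn : 1 ≤ n) (hε : 0 < ε) (hε1 : ε < 1) (hδ : 0 < δ)
    (hδ2 : δ ≤ 1 / 2) :
    (copyCount n ε δ : ℝ) ≤ 330 * (n ^ 2 * (1 + Real.log n) * Real.log (1 / δ) / ε ^ 2) :=
  calc (copyCount n ε δ : ℝ)
      ≤ 110 * (n ^ 2 * (1 + Real.log n + Real.log (1 / δ)) / ε ^ 2) :=
        copyCount_le hn hε hε1 hδ (by linarith)
    _ ≤ 110 * (n ^ 2 * (3 * ((1 + Real.log n) * Real.log (1 / δ))) / ε ^ 2) := by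
        gcongr
        exact log_factor_le_of_le_half n hδ hδ2
    _ = _ := by ring

end SampleSizes

/-! ## Initialization and running time -/

section RunningTime

variable {n : ℕ} {f : (Fin n → Bool) → Bool} {ε δ : ℝ} {c c' : Config n}

/-- The variables that keep their values after the initialization and that are still needed. -/
def paramVars : Finset Var := {.n, .eps, .m1, .m2, .m5}

/-- The values of the variables in `paramVars` after the initialization. -/
noncomputable def params (n : ℕ) (ε δ : ℝ) : Var → ℝ
  | .n => n
  | .eps => ε
  | .m1 => fourierCount n ε δ
  | .m2 => setCount n ε δ
  | .m5 => sampleCount n ε δ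
  | _ => 0

theorem agrees_params_iff : c.Agrees paramVars (params n ε δ) ↔
    c.reg .n = n ∧ c.reg .eps = ε ∧ c.reg .m1 = fourierCount n ε δ ∧
      c.reg .m2 = setCount n ε δ ∧ c.reg .m5 = sampleCount n ε δ := by
  simp [Config.Agrees, paramVars, params]

theorem triple_initialization (hn : 1 ≤ n) (hε : 0 < ε) (hδ : 0 < δ) (hδ1 : δ < 1) :
    Triple f (· = initConfig n ε δ) initialization (Config.Agrees paramVars (params n ε δ)) 0 := by
  rw [triple_zero_iff]
  rintro c rfl c' h
  have : (0 : ℝ) < n := by exact_mod_cast hn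
  have h_log := log_two_div_div_three_pos hδ hδ1
  have h_log_n := log_two_div_div_three_mul_pos hn hδ hδ1
  have h_m2 : (⌈(n : ℝ) * n * Real.log (2 / (δ / 3)) / (2 * (ε / 3 * (ε / 3)))⌉ : ℝ) =
      setCount n ε δ := by
    rw [setCount, ← sq, ← sq]
    exact (natCast_ceil_eq_intCast_ceil (by positivity)).symm
  have h_m1 : (⌈18 * Real.log (2 / (δ / 3))⌉ : ℝ) = (⌈18 * Real.log (2 / (δ / 3))⌉₊ : ℝ) :=
    (natCast_ceil_eq_intCast_ceil (by positivity)).symm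
  have h_m5 : (⌈4 * Real.log (2 / (δ / (3 * n))) / (ε / (3 * n) * (ε / (3 * n)))⌉ : ℝ) =
      sampleCount n ε δ := by
    rw [sampleCount, ← sq]
    exact (natCast_ceil_eq_intCast_ceil (by positivity)).symm
  have h_max : (fourierCount n ε δ : ℝ) =
      max (3 * (setCount n ε δ : ℝ)) ⌈18 * Real.log (2 / (δ / 3))⌉₊ := by
    simp [fourierCount]
  simp only [initialization, Prog.exec, PMF.pure_bind] at h
  rw [agrees_params_iff, h_max]
  split_ifs at h with h_le <;>
    simp only [PMF.pure_bind, PMF.mem_support_pure_iff] at h <;>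
    subst h
  · replace h_le : ⌈18 * Real.log (2 / (δ / 3))⌉₊ ≤ 3 * (setCount n ε δ : ℝ) := by
      simpa [Config.val, initConfig, h_m1, h_m2] using h_le
    simp [Config.val, initConfig, h_m1, h_m2, h_m5, h_le]
  · replace h_le : 3 * (setCount n ε δ : ℝ) < ⌈18 * Real.log (2 / (δ / 3))⌉₊ := by
      simpa [Config.val, initConfig, h_m1, h_m2] using h_le
    simp [Config.val, initConfig, h_m1, h_m2, h_m5, h_le.le]

/-- The part of the tester that follows the classical samples. -/
def evaluation : Prog :=
  .loop .i Var.n (.store Var.i (.arr Var.i / Var.m5));;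
  .assign .gsum 0;;
  .loop .i Var.n (.assign .gsum (Var.gsum + .arr Var.i));;
  .assign .phat (Var.Ihat / (2 * Var.n) - Var.gsum / (2 * Var.n));;
  .ifLE Var.phat (Var.eps / (3 * Var.n))
    (.answer true)
    (.ifLE (2 * Var.eps / (3 * Var.n)) Var.phat (.answer false) .skip)

/-- The part of the tester that follows the initialization. -/
def testerBody : Prog :=
  .assign .found 0;;
  .assign .total 0;;
  .loop .ell Var.m1 fourierAttempt;;
  .assign .Ihat (Var.total / Var.m2);;
  .loop .i Var.n (.store Var.i 0);;
  .loop .ell Var.m5 classicalSample;;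
  evaluation

theorem tester_eq : tester = (initialization;; testerBody) := rfl

theorem initialization_cost (h : c' ∈ (initialization.exec f c).support) :
    c'.steps ≤ c.steps + 100 ∧ c'.copies = c.copies := by
  have h_cost :=
    Prog.exec_cost (V := ∅) (r := 0) (by decide) (by decide) (by simp [Config.Agrees]) h
  have h_steps : initialization.stepBound n 0 ≤ 100 := by
    simp [initialization, Prog.stepBound]
  have h_copies : initialization.numCopies 0 = 0 := rfl
  omega

theorem fourierAttempt_stepBound_le (m : ℕ) :
    fourierAttempt.stepBound m (params n ε δ) ≤ m + 10 * n + 50 := by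
  have h_succ : ⌊(n : ℝ) + 1⌋₊ = n + 1 := by exact_mod_cast Nat.floor_natCast (n + 1)
  simp only [fourierAttempt, Prog.stepBound, CExpr.eval_add, CExpr.eval_var, CExpr.eval_ofNat,
    CExpr.cost_add, CExpr.cost_var, CExpr.cost_ofNat, params, Nat.cast_one, Nat.floor_natCast,
    h_succ]
  omega

theorem classicalSample_stepBound_le (m : ℕ) :
    classicalSample.stepBound m (params n ε δ) ≤ m + 19 * n + 50 := by
  simp only [classicalSample, Prog.stepBound, CExpr.eval_var, CExpr.cost_add, CExpr.cost_sub,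
    CExpr.cost_mul, CExpr.cost_arr, CExpr.cost_var, CExpr.cost_ofNat, params, Nat.floor_natCast]
  omega

theorem evaluation_stepBound_le (m : ℕ) :
    evaluation.stepBound m (params n ε δ) ≤ 13 * n + 50 := by
  simp only [evaluation, Prog.stepBound, CExpr.eval_var, CExpr.cost_add, CExpr.cost_sub,
    CExpr.cost_mul, CExpr.cost_div, CExpr.cost_arr, CExpr.cost_var, CExpr.cost_ofNat, params,
    Nat.floor_natCast]
  omega

theorem testerBody_stepBound_le : testerBody.stepBound n (params n ε δ) ≤
    copyCount n ε δ * (20 * n + 51) + (17 * n + 70) := by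
  have h_fourier : fourierAttempt.stepBound n (params n ε δ) ≤ 20 * n + 50 := by
    linarith [fourierAttempt_stepBound_le (n := n) (ε := ε) (δ := δ) n]
  calc testerBody.stepBound n (params n ε δ)
      = fourierCount n ε δ * (1 + fourierAttempt.stepBound n (params n ε δ)) +
          sampleCount n ε δ * (1 + classicalSample.stepBound n (params n ε δ)) +
          evaluation.stepBound n (params n ε δ) + (4 * n + 14) := by
        simp only [testerBody, Prog.stepBound, CExpr.eval_var, CExpr.cost_div, CExpr.cost_var,
          CExpr.cost_ofNat, params, Nat.floor_natCast]
        ring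
    _ ≤ fourierCount n ε δ * (1 + (20 * n + 50)) + sampleCount n ε δ * (1 + (n + 19 * n + 50)) +
          (13 * n + 50) + (4 * n + 14) := by
        gcongr
        · exact classicalSample_stepBound_le n
        · exact evaluation_stepBound_le n
    _ ≤ copyCount n ε δ * (20 * n + 51) + (17 * n + 70) := by
        rw [copyCount_eq]
        linarith

theorem testerBody_cost (hc : c.Agrees paramVars (params n ε δ))
    (h : c' ∈ (testerBody.exec f c).support) :
    c'.steps ≤ c.steps + (copyCount n ε δ * (20 * n + 51) + (17 * n + 70)) ∧
      c'.copies = c.copies + copyCount n ε δ := by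
  have h_cost := Prog.exec_cost (by decide) (by decide) hc h
  have h_steps := testerBody_stepBound_le (n := n) (ε := ε) (δ := δ)
  have h_copies : testerBody.numCopies (params n ε δ) = copyCount n ε δ := by
    simp [testerBody, evaluation, fourierAttempt, classicalSample, Prog.numCopies, params,
      copyCount_eq]
  omega

theorem copies_eq_and_steps_le (hn : 1 ≤ n) (hε : 0 < ε) (hδ : 0 < δ) (hδ1 : δ < 1)
    (hc : c ∈ (runTester f ε δ).support) :
    c.copies = copyCount n ε δ ∧ c.steps ≤ 80 * (n * copyCount n ε δ) + 190 * n := by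
  rw [runTester, tester_eq, Prog.exec, PMF.mem_support_bind_iff] at hc
  obtain ⟨c₁, h_init, h_body⟩ := hc
  have h_params := triple_zero_iff.mp (triple_initialization hn hε hδ hδ1) _ rfl c₁ h_init
  obtain ⟨h_steps₁, h_copies₁⟩ := initialization_cost h_init
  obtain ⟨h_steps, h_copies⟩ := testerBody_cost h_params h_body
  have h_steps_zero : (initConfig n ε δ).steps = 0 := rfl
  have h_copies_zero : (initConfig n ε δ).copies = 0 := rfl
  exact ⟨by omega, by nlinarith⟩

theorem runTester_steps_le (hn : 1 ≤ n) (hε : 0 < ε) (hε1 : ε < 1) (hδ : 0 < δ) (hδ1 : δ < 1)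
    (hc : c ∈ (runTester f ε δ).support) :
    (c.steps : ℝ) ≤ 10000 * (n ^ 3 * (1 + Real.log n + Real.log (1 / δ)) / ε ^ 2) := by
  have h_scale : 1 ≤ n ^ 2 * (1 + Real.log n + Real.log (1 / δ)) / ε ^ 2 :=
    (one_le_log_factor n hδ hδ1).trans (log_factor_le_copyScale hn hε hε1 hδ hδ1)
  calc (c.steps : ℝ)
      ≤ 80 * (n * copyCount n ε δ) + 190 * n := by
        exact_mod_cast (copies_eq_and_steps_le hn hε hδ hδ1 hc).2
    _ ≤ 80 * (n * (110 * (n ^ 2 * (1 + Real.log n + Real.log (1 / δ)) / ε ^ 2))) +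
        190 * (n * (n ^ 2 * (1 + Real.log n + Real.log (1 / δ)) / ε ^ 2)) := by
        gcongr
        · exact copyCount_le hn hε hε1 hδ hδ1
        · exact le_mul_of_one_le_right n.cast_nonneg h_scale
    _ = 8990 * (n ^ 3 * (1 + Real.log n + Real.log (1 / δ)) / ε ^ 2) := by ring
    _ ≤ _ := by
        have h_log := one_le_log_factor n hδ hδ1
        gcongr
        norm_num

end RunningTime

/-! ## Correctness -/

section TripleRules

open scoped ENNReal

variable {n : ℕ} {f : (Fin n → Bool) → Bool} {p : Prog} {P Q : Config n → Prop} {r : ℝ≥0∞}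

theorem Triple.frame {V : Finset Var} {A : Config n → Prop} (h : Triple f P p Q r)
    (hV : Disjoint p.written V)
    (hA : ∀ c c' : Config n, (∀ v ∈ V, c'.reg v = c.reg v) → A c → A c') :
    Triple f (fun c => A c ∧ P c) p (fun c => A c ∧ Q c) r := by
  have h_keep : Triple f A p A 0 := triple_zero_iff.mpr fun c hc c' hc' =>
    hA c c' (fun v hv => Prog.reg_eq_of_notMem_written (Finset.disjoint_right.mp hV hv) hc') hc
  exact ((h_keep.mono (fun _ h => h.1) (fun _ => id) le_rfl).and
    (h.mono (fun _ h => h.2) (fun _ => id) le_rfl)).mono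
    (fun _ => id) (fun _ => id) (zero_add r).le

theorem Config.Agrees.congr {V : Finset Var} {s : Var → ℝ} (c c' : Config n)
    (h : ∀ v ∈ V, c'.reg v = c.reg v) (hc : c.Agrees V s) : c'.Agrees V s :=
  fun v hv => (h v hv).trans (hc v hv)

theorem triple_assign {v : Var} {e : CExpr}
    (h : ∀ c, P c → Q ((c.set v (c.val e)).tick (1 + e.cost))) :
    Triple f P (.assign v e) Q 0 := by
  rw [triple_zero_iff]
  intro c hc c' hc'
  rw [Prog.exec, PMF.mem_support_pure_iff] at hc'
  exact hc' ▸ h c hc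

theorem triple_storeLoop {V : Finset Var} {s : Var → ℝ} {e : CExpr} {A B : Fin n → ℝ → Prop}
    (h_i : Var.i ∉ V) (h_n : Var.n ∈ V) (hs : s .n = n)
    (he : ∀ (c : Config n) (j : Fin n), c.Agrees V s → c.reg .i = j → A j (c.mem j) →
      B j (c.val e)) :
    Triple f (fun c => c.Agrees V s ∧ ∀ j : Fin n, A j (c.mem j))
      (.loop .i Var.n (.store Var.i e)) (fun c => ∀ j : Fin n, B j (c.mem j)) 0 := by
  refine (triple_loop (K := n) (I := fun k c => c.Agrees V s ∧
    ∀ j : Fin n, if j < k then B j (c.mem j) else A j (c.mem j)) (fun c hc => ?_)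
    (fun c hc => ⟨hc.1, by simpa using hc.2⟩) fun k hk => ?_).mono (fun _ => id)
    (fun c hc j => by simpa using hc.2 j) le_rfl
  · simp [Config.idx, Config.val, hc.1 _ h_n, hs]
  · rw [triple_zero_iff]
    rintro _ ⟨c, ⟨h_agrees, h_mem⟩, rfl⟩ c' hc'
    rw [Prog.exec, PMF.mem_support_pure_iff] at hc'
    subst hc'
    have h_agrees' := h_agrees.set_tick h_i k 1
    refine ⟨h_agrees', fun j => ?_⟩
    have h_idx : ((c.set .i k).tick 1).idx Var.i = k := by simp [Config.idx, Config.val]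
    have h_j := h_mem j
    rcases lt_trichotomy (j : ℕ) k with h_lt | h_eq | h_gt
    · simpa [h_idx, h_lt, h_lt.trans k.lt_succ_self, h_lt.ne] using h_j
    · subst h_eq
      simpa [h_idx] using he _ j h_agrees' (by simp) (by simpa using h_j)
    · simpa [h_idx, h_gt.not_gt, h_gt.ne', Nat.lt_succ_iff, h_gt.not_ge] using h_j

theorem triple_sumLoop {V : Finset Var} {s : Var → ℝ} {A : (ℕ → ℝ) → Prop}
    (h_i : Var.i ∉ V) (h_gsum : Var.gsum ∉ V) (h_n : Var.n ∈ V) (hs : s .n = n) :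
    Triple f (fun c => c.Agrees V s ∧ A c.mem ∧ c.reg .gsum = 0)
      (.loop .i Var.n (.assign .gsum (Var.gsum + .arr Var.i)))
      (fun c => A c.mem ∧ c.reg .gsum = ∑ j : Fin n, c.mem j) 0 := by
  refine (triple_loop (K := n) (I := fun k c => c.Agrees V s ∧ A c.mem ∧
    c.reg .gsum = ∑ j ∈ Finset.range k, c.mem j) (fun c hc => ?_)
    (fun c hc => ⟨hc.1, hc.2.1, by simpa using hc.2.2⟩) fun k _ => triple_assign ?_).mono
    (fun _ => id) (fun c hc => by simpa only [Finset.sum_range] using hc.2) le_rfl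
  · simp [Config.idx, Config.val, hc.1 _ h_n, hs]
  · rintro _ ⟨c, ⟨h_agrees, h_mem, h_sum⟩, rfl⟩
    exact ⟨(h_agrees.set_tick h_i k 1).set_tick h_gsum _ _, h_mem,
      by simp [Config.val, Finset.sum_range_succ, h_sum]⟩

end TripleRules

section Correctness

open scoped ENNReal

variable {n : ℕ} {f : (Fin n → Bool) → Bool} {ε δ : ℝ}

/-- The success event of the tester: the answer and all estimates are as promised. -/
def Correct (f : (Fin n → Bool) → Bool) (ε : ℝ) (c : Config n) : Prop :=
  (Monotone f → c.out = some true) ∧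
    (FarFromMonotone ε f → c.out = some false) ∧
    |c.reg Var.Ihat - totalInfluence (signFn f)| ≤ ε / 3 ∧
    (∀ i : Fin n, |c.mem i - cubeFourier (signFn f) {i}| ≤ ε / (3 * n)) ∧
    |c.reg Var.phat - violationProb f| ≤ ε / (3 * n)

/-- The parameters have their values, and `Ihat` estimates the total influence: what the
initialization and the Fourier sampling achieve. -/
structure InfluenceEstimated (f : (Fin n → Bool) → Bool) (ε δ : ℝ) (c : Config n) : Prop where
  agrees : c.Agrees paramVars (params n ε δ)
  influence : |c.reg .Ihat - totalInfluence (signFn f)| ≤ ε / 3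

theorem InfluenceEstimated.congr (c c' : Config n)
    (h : ∀ v ∈ insert .Ihat paramVars, c'.reg v = c.reg v) (hc : InfluenceEstimated f ε δ c) :
    InfluenceEstimated f ε δ c' :=
  ⟨hc.agrees.congr c c' fun v hv => h v (Finset.mem_insert_of_mem hv),
    (h .Ihat (by decide)).symm ▸ hc.influence⟩

/-- The array estimates the degree-one Fourier coefficients: what the classical samples achieve. -/
def CoefficientsEstimated (f : (Fin n → Bool) → Bool) (ε : ℝ) (m : ℕ → ℝ) : Prop :=
  ∀ i : Fin n, |m i - cubeFourier (signFn f) {i}| ≤ ε / (3 * n)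

theorem abs_estimate_sub_violationProb_le (hn : 1 ≤ n) {I : ℝ} {g : Fin n → ℝ}
    (hI : |I - totalInfluence (signFn f)| ≤ ε / 3)
    (hg : ∀ i, |g i - cubeFourier (signFn f) {i}| ≤ ε / (3 * n)) :
    |I / (2 * n) - (∑ i, g i) / (2 * n) - violationProb f| ≤ ε / (3 * n) := by
  have : (0 : ℝ) < n := by exact_mod_cast hn
  have h_sum : |∑ i, (g i - cubeFourier (signFn f) {i})| ≤ ε / 3 :=
    calc _ ≤ ∑ i : Fin n, ε / (3 * n) :=
          (Finset.abs_sum_le_sum_abs _ _).trans (Finset.sum_le_sum fun i _ => hg i)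
      _ = ε / 3 := by
          rw [Finset.sum_const, Finset.card_univ, Fintype.card_fin, nsmul_eq_mul]
          field_simp
  have h_diff : I / (2 * n) - (∑ i, g i) / (2 * n) - violationProb f =
      ((I - totalInfluence (signFn f)) - ∑ i, (g i - cubeFourier (signFn f) {i})) / (2 * n) := by
    rw [violationProb_eq_fourier, Finset.sum_sub_distrib]
    ring
  have h_pos : (0 : ℝ) < 2 * n := by positivity
  rw [h_diff, abs_div, abs_of_pos h_pos, div_le_iff₀ h_pos]
  calc _ ≤ ε / 3 + ε / 3 := (abs_sub _ _).trans (add_le_add hI h_sum)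
    _ = ε / (3 * n) * (2 * n) := by
        field_simp
        norm_num

theorem triple_decision (hn : 1 ≤ n) (hε : 0 < ε) :
    Triple f
      (fun c => InfluenceEstimated f ε δ c ∧ CoefficientsEstimated f ε c.mem ∧
        |c.reg .phat - violationProb f| ≤ ε / (3 * n))
      (.ifLE Var.phat (Var.eps / (3 * Var.n)) (.answer true)
        (.ifLE (2 * Var.eps / (3 * Var.n)) Var.phat (.answer false) .skip))
      (Correct f ε) 0 := by
  rw [triple_zero_iff]
  rintro c ⟨hc, h_mem, h_phat⟩ c' hc'
  have : (0 : ℝ) < n := by exact_mod_cast hn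
  have h_n : c.reg .n = n := hc.agrees .n (by decide)
  have h_eps : c.reg .eps = ε := hc.agrees .eps (by decide)
  have h_pos : 0 < ε / (3 * n) := by positivity
  have h_abs := abs_le.mp h_phat
  have h_monotone : Monotone f → c.reg .phat ≤ ε / (3 * n) := fun hf => by
    linarith [violationProb_of_monotone hf]
  have h_far : FarFromMonotone ε f → 2 * ε / (3 * n) ≤ c.reg .phat := fun hf => by
    have h_prob := hf.le_violationProb
    have h_split : ε / n = 2 * ε / (3 * n) + ε / (3 * n) := by
      field_simp
      norm_num
    linarith
  have h_lt : ε / (3 * n) < 2 * ε / (3 * n) := by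
    rw [mul_div_assoc]
    linarith
  simp only [Prog.exec, Config.val, CExpr.eval_var, CExpr.eval_div, CExpr.eval_mul,
    CExpr.eval_ofNat, Config.reg_tick, h_n, h_eps, Nat.cast_ofNat] at hc'
  split_ifs at hc' with h_accept h_reject <;>
    rw [PMF.mem_support_pure_iff] at hc' <;>
    subst hc' <;>
    refine ⟨fun hf => ?_, fun hf => ?_, hc.influence, h_mem, h_phat⟩
  · rfl
  · linarith [h_far hf]
  · exact absurd (h_monotone hf) h_accept
  · rfl
  · exact absurd (h_monotone hf) h_accept
  · exact absurd (h_far hf) h_reject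

theorem triple_normalizeLoop :
    Triple f
      (fun c => InfluenceEstimated f ε δ c ∧
        CoefficientsEstimated f ε fun j => c.mem j / sampleCount n ε δ)
      (.loop .i Var.n (.store Var.i (.arr Var.i / Var.m5)))
      (fun c => InfluenceEstimated f ε δ c ∧ CoefficientsEstimated f ε c.mem) 0 := by
  have h_store : Triple f
      (fun c => c.Agrees paramVars (params n ε δ) ∧
        CoefficientsEstimated f ε fun j => c.mem j / sampleCount n ε δ)
      (.loop .i Var.n (.store Var.i (.arr Var.i / Var.m5)))
      (fun c => CoefficientsEstimated f ε c.mem) 0 :=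
    triple_storeLoop (V := paramVars) (s := params n ε δ)
      (A := fun i x => |x / sampleCount n ε δ - cubeFourier (signFn f) {i}| ≤ ε / (3 * n))
      (B := fun i x => |x - cubeFourier (signFn f) {i}| ≤ ε / (3 * n))
      (by decide) (by decide) rfl fun c i hc h_i h => by
      have h_m5 : c.reg .m5 = sampleCount n ε δ := hc .m5 (by decide)
      simpa [Config.val, h_i, h_m5] using h
  exact (h_store.frame (by decide) InfluenceEstimated.congr).mono
    (fun c hc => ⟨hc.1, hc.1.agrees, hc.2⟩) (fun _ => id) le_rfl

theorem triple_sum :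
    Triple f
      (fun c => InfluenceEstimated f ε δ c ∧ CoefficientsEstimated f ε c.mem ∧ c.reg .gsum = 0)
      (.loop .i Var.n (.assign .gsum (Var.gsum + .arr Var.i)))
      (fun c => InfluenceEstimated f ε δ c ∧ CoefficientsEstimated f ε c.mem ∧
        c.reg .gsum = ∑ i : Fin n, c.mem i) 0 :=
  ((triple_sumLoop (V := paramVars) (s := params n ε δ) (by decide) (by decide) (by decide)
    rfl).frame (V := insert .Ihat paramVars) (by decide) InfluenceEstimated.congr).mono
    (fun _ hc => ⟨hc.1, hc.1.agrees, hc.2⟩) (fun _ => id) le_rfl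

theorem triple_phat (hn : 1 ≤ n) :
    Triple f
      (fun c => InfluenceEstimated f ε δ c ∧ CoefficientsEstimated f ε c.mem ∧
        c.reg .gsum = ∑ i : Fin n, c.mem i)
      (.assign .phat (Var.Ihat / (2 * Var.n) - Var.gsum / (2 * Var.n)))
      (fun c => InfluenceEstimated f ε δ c ∧ CoefficientsEstimated f ε c.mem ∧
        |c.reg .phat - violationProb f| ≤ ε / (3 * n)) 0 :=
  triple_assign fun c ⟨hc, h_mem, h_sum⟩ => by
    have h_n : c.reg .n = n := hc.agrees .n (by decide)
    refine ⟨hc.congr c _ (by simp [paramVars]), h_mem, ?_⟩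
    simpa [Config.val, h_n, h_sum] using abs_estimate_sub_violationProb_le hn hc.influence h_mem

theorem triple_evaluation (hn : 1 ≤ n) (hε : 0 < ε) :
    Triple f
      (fun c => InfluenceEstimated f ε δ c ∧
        CoefficientsEstimated f ε fun j => c.mem j / sampleCount n ε δ)
      evaluation (Correct f ε) 0 := by
  have h_zero : Triple f
      (fun c => InfluenceEstimated f ε δ c ∧ CoefficientsEstimated f ε c.mem) (.assign .gsum 0)
      (fun c => InfluenceEstimated f ε δ c ∧ CoefficientsEstimated f ε c.mem ∧
        c.reg .gsum = 0) 0 :=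
    triple_assign fun c hc =>
      ⟨hc.1.congr c _ (by simp [paramVars]), hc.2, by simp [Config.val]⟩
  exact (triple_normalizeLoop.seq <| h_zero.seq <| triple_sum.seq <| (triple_phat hn).seq <|
    triple_decision hn hε).mono (fun _ => id) (fun _ => id) (by simp only [add_zero, le_refl])

theorem triple_fourierSampling (hn : 1 ≤ n) (hε : 0 < ε) (hδ : 0 < δ) (hδ1 : δ < 1) :
    Triple f (fun c => c.Agrees paramVars (params n ε δ) ∧ c.reg .found = 0 ∧ c.reg .total = 0)
      (.loop .ell Var.m1 fourierAttempt)
      (fun c => c.Agrees paramVars (params n ε δ) ∧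
        |c.reg .total / setCount n ε δ - totalInfluence (signFn f)| ≤ ε / 3)
      (ENNReal.ofReal (δ / 2)) := by
  have h_eexp {x : ℝ} (h : Real.log (2 / (δ / 3)) ≤ x) : eexp (-x) ≤ ENNReal.ofReal (δ / 6) := by
    refine eexp_neg_le_of_log_le (by positivity) (le_trans (le_of_eq ?_) h)
    congr 1
    field_simp
    norm_num
  have h_loop := (triple_fourierLoop (f := f) hn (setCount_pos hn hε hδ hδ1)
    (le_max_left _ _ : _ ≤ fourierCount n ε δ) (show 0 < ε / 3 by positivity)).frame
    (V := paramVars) (A := Config.Agrees paramVars (params n ε δ)) (by decide) Config.Agrees.congr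
  refine h_loop.mono (fun c hc => ⟨hc.1, ?_⟩) (fun _ => id) ?_
  · exact ⟨hc.1 .n (by decide), hc.1 .m2 (by decide), hc.1 .m1 (by decide), hc.2.1, hc.2.2⟩
  · calc _ ≤ ENNReal.ofReal (δ / 6) + (ENNReal.ofReal (δ / 6) + ENNReal.ofReal (δ / 6)) := by
          gcongr
          · exact h_eexp log_le_fourierCount_div
          · exact h_eexp (log_le_setCount_mul hn hε)
          · exact h_eexp (log_le_setCount_mul hn hε)
      _ = ENNReal.ofReal (δ / 2) := by
          rw [← ENNReal.ofReal_add (by positivity) (by positivity),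
            ← ENNReal.ofReal_add (by positivity) (by positivity)]
          congr 1
          ring

theorem triple_classicalSampling (hn : 1 ≤ n) (hε : 0 < ε) (hδ : 0 < δ) (hδ1 : δ < 1) :
    Triple f (fun c => InfluenceEstimated f ε δ c ∧ ∀ i : Fin n, c.mem i = 0)
      (.loop .ell Var.m5 classicalSample)
      (fun c => InfluenceEstimated f ε δ c ∧
        CoefficientsEstimated f ε fun j => c.mem j / sampleCount n ε δ)
      (ENNReal.ofReal (δ / 3)) := by
  have : (0 : ℝ) < n := by exact_mod_cast hn
  have h_eexp : eexp (-(sampleCount n ε δ * (ε / (3 * n)) ^ 2 / 2)) ≤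
      ENNReal.ofReal (δ / (6 * n)) := by
    refine eexp_neg_le_of_log_le (by positivity)
      (le_trans (le_of_eq ?_) (log_le_sampleCount_mul hn hε hδ hδ1))
    congr 1
    field_simp
    norm_num
  have h_bound : (Fintype.card (Fin n) : ℝ≥0∞) *
      (ENNReal.ofReal (δ / (6 * n)) + ENNReal.ofReal (δ / (6 * n))) = ENNReal.ofReal (δ / 3) := by
    rw [Fintype.card_fin, ← ENNReal.ofReal_add (by positivity) (by positivity),
      ← ENNReal.ofReal_natCast, ← ENNReal.ofReal_mul n.cast_nonneg]
    congr 1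
    field_simp
    norm_num
  refine (Triple.frame (V := insert .Ihat paramVars)
    (Triple.forall fun i => (triple_sampleLoop (f := f) (sampleCount_pos hn hε hδ hδ1) i
      (show 0 < ε / (3 * n) by positivity)).mono
      (P' := fun c => InfluenceEstimated f ε δ c ∧ ∀ i : Fin n, c.mem i = 0)
      (fun c hc => ?_) (fun _ => id) (add_le_add h_eexp h_eexp))
    (by decide) InfluenceEstimated.congr).mono
    (fun c hc => ⟨hc.1, hc⟩) (fun _ => id) h_bound.le
  exact ⟨hc.1.agrees .n (by decide), hc.1.agrees .m5 (by decide), hc.2 i⟩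

theorem triple_testerBody (hn : 1 ≤ n) (hε : 0 < ε) (hδ : 0 < δ) (hδ1 : δ < 1) :
    Triple f (Config.Agrees paramVars (params n ε δ)) testerBody (Correct f ε)
      (ENNReal.ofReal δ) := by
  have h_found : Triple f (Config.Agrees paramVars (params n ε δ)) (.assign .found 0)
      (fun c => c.Agrees paramVars (params n ε δ) ∧ c.reg .found = 0) 0 :=
    triple_assign fun c hc => ⟨hc.set_tick (by decide) _ _, by simp [Config.val]⟩
  have h_total : Triple f (fun c => c.Agrees paramVars (params n ε δ) ∧ c.reg .found = 0)
      (.assign .total 0) (fun c => c.Agrees paramVars (params n ε δ) ∧ c.reg .found = 0 ∧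
        c.reg .total = 0) 0 :=
    triple_assign fun c hc =>
      ⟨hc.1.set_tick (by decide) _ _, by simpa using hc.2, by simp [Config.val]⟩
  have h_Ihat : Triple f (fun c => c.Agrees paramVars (params n ε δ) ∧
        |c.reg .total / setCount n ε δ - totalInfluence (signFn f)| ≤ ε / 3)
      (.assign .Ihat (Var.total / Var.m2)) (InfluenceEstimated f ε δ) 0 :=
    triple_assign fun c ⟨hc, h_total⟩ => by
      have h_m2 : c.reg .m2 = setCount n ε δ := hc .m2 (by decide)
      exact ⟨hc.set_tick (by decide) _ _, by simpa [Config.val, h_m2] using h_total⟩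
  have h_zero : Triple f (InfluenceEstimated f ε δ) (.loop .i Var.n (.store Var.i 0))
      (fun c => InfluenceEstimated f ε δ c ∧ ∀ i : Fin n, c.mem i = 0) 0 :=
    ((triple_storeLoop (A := fun _ _ => True) (B := fun _ x => x = 0) (V := paramVars)
      (s := params n ε δ) (by decide) (by decide) rfl
      fun _ _ _ _ _ => by simp [Config.val]).frame (V := insert .Ihat paramVars) (by decide)
      InfluenceEstimated.congr).mono
      (fun c hc => ⟨hc, hc.agrees, fun _ => trivial⟩) (fun _ => id) le_rfl
  refine (h_found.seq <| h_total.seq <| (triple_fourierSampling hn hε hδ hδ1).seq <|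
    h_Ihat.seq <| h_zero.seq <| (triple_classicalSampling hn hε hδ hδ1).seq <|
    triple_evaluation hn hε).mono (fun _ => id) (fun _ => id) ?_
  rw [zero_add, zero_add, zero_add, zero_add, add_zero,
    ← ENNReal.ofReal_add (by positivity) (by positivity)]
  exact ENNReal.ofReal_le_ofReal (by linarith)

theorem le_toOuterMeasure_correct (hn : 1 ≤ n) (hε : 0 < ε) (hδ : 0 < δ) (hδ1 : δ < 1) :
    ENNReal.ofReal (1 - δ) ≤ (runTester f ε δ).toOuterMeasure {c | Correct f ε c} := by
  have h_tester : Triple f (· = initConfig n ε δ) tester (Correct f ε) (0 + ENNReal.ofReal δ) :=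
    tester_eq ▸ (triple_initialization hn hε hδ hδ1).seq (triple_testerBody hn hε hδ hδ1)
  have h_fail : (runTester f ε δ).toOuterMeasure {c | ¬ Correct f ε c} ≤ ENNReal.ofReal δ :=
    zero_add (ENNReal.ofReal δ) ▸ h_tester _ rfl
  have h_total : (runTester f ε δ).toOuterMeasure ({c | Correct f ε c} ∪ {c | ¬ Correct f ε c}) =
      1 := by
    rw [PMF.toOuterMeasure_apply_eq_one_iff]
    exact fun c _ => em (Correct f ε c)
  rw [ENNReal.ofReal_sub _ hδ.le, ENNReal.ofReal_one, tsub_le_iff_right, ← h_total]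
  exact (MeasureTheory.measure_union_le _ _).trans (add_le_add le_rfl h_fail)

end Correctness

end QTest

theorem mainTheorem1 :
    -- the violation probability in terms of Fourier-analytic quantities
    (∀ (n : ℕ), 1 ≤ n → ∀ f : (Fin n → Bool) → Bool,
      violationProb f =
        (totalInfluence (signFn f) - ∑ i, cubeFourier (signFn f) {i}) / (2 * n)) ∧
    -- the tester: copies used, running time, and success probability
    ∃ C : ℝ, 0 < C ∧
      ∀ (n : ℕ), 1 ≤ n → ∀ (f : (Fin n → Bool) → Bool) (ε δ : ℝ),
        0 < ε → ε < 1 → 0 < δ → δ < 1 →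
        (∀ c ∈ (runTester f ε δ).support,
          c.copies = copyCount n ε δ ∧
          (c.steps : ℝ) ≤ C * (n ^ 3 * (1 + Real.log n + Real.log (1 / δ)) / ε ^ 2)) ∧
        (copyCount n ε δ : ℝ) ≤ C * (n ^ 2 * (1 + Real.log n + Real.log (1 / δ)) / ε ^ 2) ∧
        (δ ≤ 1 / 2 →
          (copyCount n ε δ : ℝ) ≤ C * (n ^ 2 * (1 + Real.log n) * Real.log (1 / δ) / ε ^ 2)) ∧
        ENNReal.ofReal (1 - δ) ≤
          (runTester f ε δ).toOuterMeasure
            {c | (Monotone f → c.out = some true) ∧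
              (FarFromMonotone ε f → c.out = some false) ∧
              |c.reg Var.Ihat - totalInfluence (signFn f)| ≤ ε / 3 ∧
              (∀ i : Fin n, |c.mem i - cubeFourier (signFn f) {i}| ≤ ε / (3 * n)) ∧
              |c.reg Var.phat - violationProb f| ≤ ε / (3 * n)} := by
  refine ⟨fun n _ f => violationProb_eq_fourier f, 10000, by norm_num,
    fun n hn f ε δ hε hε1 hδ hδ1 => ⟨fun c hc => ⟨(copies_eq_and_steps_le hn hε hδ hδ1 hc).1,
      runTester_steps_le hn hε hε1 hδ hδ1 hc⟩, (copyCount_le hn hε hε1 hδ hδ1).trans ?_,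
      fun hδ2 => (copyCount_le_of_le_half hn hε hε1 hδ hδ2).trans ?_,
      le_toOuterMeasure_correct hn hε hδ hδ1⟩⟩
  · have h_log := one_le_log_factor n hδ hδ1
    gcongr
    norm_num
  · have := Real.log_natCast_nonneg n
    have h_log_δ := log_inv_nonneg hδ hδ1
    gcongr
    norm_num
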